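/- **Network.** A Markov decision processing network has request queues $Q(t)\in\mathbb Z_+^R$ and a finite server state $Z(t)$. When action $a$ (from a finite set) is chosen in server state $z$, the next server state $z'$ and the schedule $\sigma\in\mathbb Z_+^R$ are drawn from a given joint law $P(z',\sigma\mid a,z)$, with mean schedule $\sigma(a,z)=\mathbb E[\sigma\mid a,z]$, and $Q_r(t+1)=[Q_r(t)-\sigma_r(t)]_++\lambda_r(t)$. Here the arrivals $\lambda_r(t)$ are independent Bernoulli variables (over $r$ and $t$). A policy chooses $a(t)$, possibly at random, as a function of $(Q(t),Z(t))$; it is request-agnostic if it depends on $Z(t)$ only. A *MaxWeight* policy selects only actions maximizing $\sum_r Q_r\sigma_r(a,z)$, with ties broken in any way. Let $\mathcal C^\circ$ be the set of arrival rate vectors $\lambda\ge 0$ for which there are a request-agnostic policy $\pi$ and a stationary distribution $\mu$ of its server process with $\lambda_r<\sum_{z,a}\mu(z)\pi(a\mid z)\sigma_r(a,z)$ for all $r$. A policy is *throughput optimal* if the chain $(Q,Z)$ is positive recurrent (some state has finite mean hitting time from every state) for every arrival rate vector in $\mathcal C^\circ$. **Example.** Let $h>0$, and consider request and server types $0,1,2$.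 The memory holds at most one server of each type. A type-0 request needs one server of each of the types $0,1,2$; a type-1 (type-2) request needs one server of type 1 (type 2). In each slot one may serve, as far as the servers needed are in memory, one type-0 request, or at most one request of each of the types 1 and 2. Used servers leave; each unused stored server decoheres with probability $1-h^2$ (type 0) or $h^2$ (types 1 and 2). Then a server of type $i$ arrives with probability $\mu_ih$ (lost if that memory place is still occupied) and a request of type $i$ arrives with probability $\lambda_ih$. All these events are independent. The policy P0 uses servers only for type-0 requests while queue 0 is nonempty, and otherwise serves queues 1 and 2 whenever possible. **Theorem.** Let $\lambda_1=\lambda_2=150$, $\mu_1=\mu_2=200$, $\lambda_0=4$, $\mu_0=20$. There is $h_0\in(0,1/200]$ such that for all $0<h<h_0$: 1. the arrival rate vector $(\lambda_0h,\lambda_1h,\lambda_2h)$ belongs to $\mathcal C^\circ$; 2. under P0 the chain $(Q,Z)$ is irreducible and positive recurrent (every state has finite mean return time); 3. under every MaxWeight policy no state of $(Q,Z)$ is positive recurrent (network unstable). In particular, no MaxWeight policy is throughput optimal for this network, which has Bernoulli arrivals and probabilistic server decoherence. -/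

import Mathlib

open scoped ENNReal

noncomputable section

/-! ### Countable-state Markov chains -/

namespace MarkovChain

variable {X : Type*}

/-- `tail P y n x` is the probability, for the chain with transition law `P` started at `x`, that
none of the states visited at times `1, …, n` is `y`, i.e. `ℙ_x(τ_y > n)` where
`τ_y = inf {t ≥ 1 : X(t) = y}`. -/
def tail (P : X → PMF X) (y : X) : ℕ → X → ℝ≥0∞
  | 0, _ => 1
  | n + 1, x =>
    open Classical in ∑' x' : X, P x x' * (if x' = y then 0 else tail P y n x')

/-- The mean hitting (or, for `x = y`, return) time `𝔼_x[τ_y] = ∑_{n ≥ 0} ℙ_x(τ_y > n)`. -/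
def meanHittingTime (P : X → PMF X) (x y : X) : ℝ≥0∞ :=
  ∑' n : ℕ, tail P y n x

/-- The state `x` is positive recurrent: its mean return time is finite. -/
def PositiveRecurrentAt (P : X → PMF X) (x : X) : Prop :=
  meanHittingTime P x x < ∞

/-- Every state can be reached from every state by finitely many transitions of positive
probability. -/
def Irreducible (P : X → PMF X) : Prop :=
  ∀ x y : X, Relation.ReflTransGen (fun u v => v ∈ (P u).support) x y

/-- The chain is positive recurrent: some state is reached in finite mean time from every state
(itself included). For an irreducible chain this is the usual notion. In this form it also applies
to chains with transient states, such as a network in which some arrival rate is zero. -/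
def IsPositiveRecurrent (P : X → PMF X) : Prop :=
  ∃ y : X, ∀ x : X, meanHittingTime P x y < ∞

end MarkovChain

/-! ### Independent Bernoulli variables -/

/-- The law of a family of independent Bernoulli variables, the `i`-th one being `true` with
probability `p i`. -/
def bernoulliVec {ι : Type*} [Fintype ι] [DecidableEq ι] (p : ι → unitInterval) : PMF (ι → Bool) :=
  PMF.ofFintype (fun b => ∏ i, ENNReal.ofReal (if b i then (p i : ℝ) else 1 - (p i : ℝ))) (by
    have h := Finset.prod_univ_sum (fun _ : ι => (Finset.univ : Finset Bool))
      (fun i (b : Bool) => ENNReal.ofReal (if b then (p i : ℝ) else 1 - (p i : ℝ)))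
    rw [Fintype.piFinset_univ] at h
    rw [← h]
    refine Finset.prod_eq_one fun i _ => ?_
    rw [Fintype.sum_bool, if_pos rfl, if_neg Bool.false_ne_true,
      ← ENNReal.ofReal_add (p i).2.1 (sub_nonneg.2 (p i).2.2), add_sub_cancel, ENNReal.ofReal_one])

/-! ### Markov decision processing networks -/

/-- The service side of a Markov decision processing network with request types `R`, server
states `Z`, actions `A` and schedules `S` (all finite in the definitions below): a schedule `s`
serves `amount s r` requests of type `r`, and `kernel a z` is the joint law of the next server
state and the selected schedule when action `a` is used in server state `z`. -/
structure MDPN (R Z A S : Type*) where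
  amount : S → R → ℕ
  kernel : A → Z → PMF (Z × S)

namespace MDPN

variable {R Z A S : Type*} [Fintype R] [DecidableEq R] [Fintype Z] [Fintype A] [Fintype S]

/-- The states of the network: queue lengths and server state. -/
abbrev State (R Z : Type*) := (R → ℕ) × Z

/-- A Markovian, possibly randomized, policy. -/
abbrev Policy (R Z A : Type*) := State R Z → PMF A

/-- The Markov chain `X(t) = (Q(t), Z(t))` under the policy `π`, when requests of type `r` arrive
as independent Bernoulli processes with probability `p r` per time slot:
`Q_r(t+1) = [Q_r(t) - σ_r(t)]₊ + λ_r(t)`. -/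
def chain (N : MDPN R Z A S) (p : R → unitInterval) (π : Policy R Z A) :
    State R Z → PMF (State R Z) := fun x =>
  (π x).bind fun a => (N.kernel a x.2).bind fun y => (bernoulliVec p).map fun b =>
    (fun r => (x.1 r - N.amount y.2 r) + (b r).toNat, y.1)

/-- The average schedule `σ_r(a, z)`. -/
def meanService (N : MDPN R Z A S) (a : A) (z : Z) (r : R) : ℝ :=
  ∑ y : Z × S, (N.kernel a z y).toReal * (N.amount y.2 r : ℝ)

/-- `π` is a MaxWeight policy: in state `(Q, z)` it selects only actions that maximize
`∑_r Q_r σ_r(a, z)`. Ties may be broken in any, possibly randomized, way. -/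
def IsMaxWeight (N : MDPN R Z A S) (π : Policy R Z A) : Prop :=
  ∀ (q : R → ℕ) (z : Z), ∀ a ∈ (π (q, z)).support, ∀ a' : A,
    ∑ r, (q r : ℝ) * N.meanService a' z r ≤ ∑ r, (q r : ℝ) * N.meanService a z r

/-- The transition law of the server process under a request-agnostic policy. -/
def serverChain (N : MDPN R Z A S) (π : Z → PMF A) : Z → PMF Z := fun z =>
  (π z).bind fun a => (N.kernel a z).map Prod.fst

/-- The set of arrival rate vectors (`𝒞°`) strictly dominated by the stationary service
rates of some request-agnostic policy. -/
def interiorCapacity (N : MDPN R Z A S) : Set (R → ℝ) :=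
  {l | (∀ r, 0 ≤ l r) ∧ ∃ (π : Z → PMF A) (μ : PMF Z), μ.bind (N.serverChain π) = μ ∧
    ∀ r, l r < ∑ z, ∑ a, (μ z).toReal * (π z a).toReal * N.meanService a z r}

/-- `π` is throughput optimal (for Bernoulli arrivals): the network is positive recurrent for all
arrival rates in `𝒞°`. -/
def ThroughputOptimal (N : MDPN R Z A S) (π : Policy R Z A) : Prop :=
  ∀ p : R → unitInterval, (fun r => (p r : ℝ)) ∈ N.interiorCapacity →
    MarkovChain.IsPositiveRecurrent (N.chain p π)

end MDPN

/-! ### The three-queue network -/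

namespace ThreeQueue

/-- The real number `x` as a probability; values outside `[0, 1]` are truncated. -/
def toProb (x : ℝ) : unitInterval := Set.projIcc (0 : ℝ) 1 zero_le_one x

/-- The server types used by a request: type 0 requests need one server of each type, type 1
(type 2) requests need a server of type 1 (type 2). -/
def needs : Fin 3 → Finset (Fin 3) :=
  ![Finset.univ, {1}, {2}]

/-- The memory: whether a server of type `i` is currently stored. -/
abbrev Memory := Fin 3 → Bool

/-- The sets of requests that can be served together, at most one request per type. -/
inductive Action
  | idle
  | serve0
  | serve1
  | serve2
  | serve12
  deriving DecidableEq

instance : Fintype Action :=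
  ⟨{.idle, .serve0, .serve1, .serve2, .serve12}, fun a => by cases a <;> simp⟩

/-- The request types that an action attempts to serve. -/
def Action.requests : Action → Finset (Fin 3)
  | .idle => ∅
  | .serve0 => {0}
  | .serve1 => {1}
  | .serve2 => {2}
  | .serve12 => {1, 2}

/-- The request types that an action actually schedules: those for which all servers needed are
in memory. -/
def scheduled (a : Action) (z : Memory) : Finset (Fin 3) :=
  a.requests.filter fun r => ∀ i ∈ needs r, z i = true

/-- Whether the server of type `i` is consumed by action `a` in state `z`. -/
def used (a : Action) (z : Memory) (i : Fin 3) : Bool :=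
  decide (∃ r ∈ scheduled a z, i ∈ needs r)

/-- The decoherence probability per slot: `1 - h²` for type 0, `h²` for types 1 and 2. -/
def decoherence (h : ℝ) : Fin 3 → ℝ :=
  ![1 - h ^ 2, h ^ 2, h ^ 2]

/-- The network with server arrival probabilities `μ i * h`. In each slot the scheduled servers are
consumed, every other stored server of type `i` decoheres with probability `decoherence h i`,
and then a new server of type `i` arrives with probability `μ i * h` (it is lost if a server of
its type is still stored), all independently. -/
def network (μ : Fin 3 → ℝ) (h : ℝ) : MDPN (Fin 3) Memory Action (Finset (Fin 3)) where
  amount := fun s r => if r ∈ s then 1 else 0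
  kernel := fun a z =>
    (bernoulliVec fun i => toProb (decoherence h i)).bind fun d =>
      (bernoulliVec fun i => toProb (μ i * h)).map fun b =>
        (fun i => (z i && !used a z i && !d i) || b i, scheduled a z)

/-- The request arrival probabilities `l i * h`. -/
def arrivals (l : Fin 3 → ℝ) (h : ℝ) : Fin 3 → unitInterval :=
  fun i => toProb (l i * h)

/-- The policy P0 that gives priority to queue 0: while queue 0 is nonempty, servers are used only
for type 0 requests; when it is empty, queues 1 and 2 are served whenever they are nonempty. -/
def priorityZero : MDPN.Policy (Fin 3) Memory Action := fun x =>
  PMF.pure <|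
    if 0 < x.1 0 then .serve0
    else if 0 < x.1 1 then (if 0 < x.1 2 then .serve12 else .serve1)
    else if 0 < x.1 2 then .serve2 else .idle

end ThreeQueue

end

/-! Measure time in units of 1/h slots. As h → 0, servers and requests arrive at fixed rates, a
type-0 server survives only one slot, and servers of types 1 and 2 practically never decohere. So a
type-0 request is served only if a type-0 server arrives while servers 1 and 2 are both waiting in
memory.

MaxWeight never lets a server 1 or 2 wait while its own queue is nonempty, however long queue 0 is:
unless all three servers are present, serving queue 0 has weight zero (`served_of_isMaxWeight`).
Hence both servers wait together only when queues 1 and 2 are both empty. Each Q_j - Z_j behaves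
like a queue of load 150/200, so this occurs roughly 1/16 of the time, and type-0 service at rate
about 20/16 cannot keep up with 4. Rigorously, a modified queue 0 has uniformly positive drift
(`potential_drift`) and increments bounded above, which excludes positive recurrence
(`not_positiveRecurrentAt_of_drift`).

P0 reserves the servers while queue 0 is nonempty. A type-0 service then takes mean time 1/400 +
1/200 + 1/20 = 23/400, in which 23/2 servers of type j would arrive. Counted in such servers, work
in front of queue j arrives at rate 4 · 23/2 + 150 = 196 < 200. The sum of the squared workloads for
j = 1, 2 is therefore a Foster function (`expect_sq_workload_le`).

For the capacity region, a request-agnostic policy lets a single server 1 or 2 wait only briefly for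
its partner, and holds a pair until a type-0 server comes. Its stationary rates are not computed but
bounded below by test functions that nearly solve the Poisson equation (`lt_stationary_rate`,
`le_agnostic_drift`).

All drifts are computed to first order in h by `le_expect_events`; the O(h²) errors dictate the size
of h₀. -/

/-! ### Expectations over finite probability spaces -/

namespace PMF

variable {X Ω Ω' : Type*}

theorem tsum_bind_mul (p : PMF Ω) (f : Ω → PMF X) (F : X → ℝ≥0∞) :
    ∑' x, (p.bind f) x * F x = ∑' w, p w * ∑' x, f w x * F x := by
  simp_rw [bind_apply, ← ENNReal.tsum_mul_right, ← ENNReal.tsum_mul_left]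
  rw [ENNReal.tsum_comm]
  simp_rw [mul_assoc]

theorem tsum_pure_mul (x : X) (F : X → ℝ≥0∞) : ∑' x', (pure x) x' * F x' = F x := by
  rw [tsum_eq_single x]
  · simp
  · intro b hb
    simp [hb]

theorem tsum_map_mul (p : PMF Ω) (f : Ω → X) (F : X → ℝ≥0∞) :
    ∑' x, (p.map f) x * F x = ∑' w, p w * F (f w) := by
  rw [← bind_pure_comp, tsum_bind_mul]
  simp_rw [Function.comp, tsum_pure_mul]

/-- The expectation of a real function on a finite probability space. -/
noncomputable def expect [Fintype Ω] (p : PMF Ω) (F : Ω → ℝ) : ℝ := ∑ w, (p w).toReal * F w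

variable [Fintype Ω] [Fintype Ω']

theorem sum_toReal (p : PMF Ω) : ∑ w, (p w).toReal = 1 := by
  have h := p.tsum_coe
  rw [tsum_fintype] at h
  rw [← ENNReal.toReal_sum fun w _ => p.apply_ne_top w, h, ENNReal.toReal_one]

theorem expect_const (p : PMF Ω) (c : ℝ) : p.expect (fun _ => c) = c := by
  simp [expect, ← Finset.sum_mul, sum_toReal]

theorem expect_add (p : PMF Ω) (F G : Ω → ℝ) :
    p.expect (fun w => F w + G w) = p.expect F + p.expect G := by
  simp [expect, mul_add, Finset.sum_add_distrib]

theorem expect_sub (p : PMF Ω) (F G : Ω → ℝ) :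
    p.expect (fun w => F w - G w) = p.expect F - p.expect G := by
  simp [expect, mul_sub, Finset.sum_sub_distrib]

theorem expect_const_mul (p : PMF Ω) (c : ℝ) (F : Ω → ℝ) :
    p.expect (fun w => c * F w) = c * p.expect F := by
  simp only [expect, Finset.mul_sum]
  exact Finset.sum_congr rfl fun w _ => by ring

theorem expect_mono (p : PMF Ω) {F G : Ω → ℝ} (h : ∀ w ∈ p.support, F w ≤ G w) :
    p.expect F ≤ p.expect G := by
  refine Finset.sum_le_sum fun w _ => ?_
  by_cases hw : w ∈ p.support
  · exact mul_le_mul_of_nonneg_left (h w hw) ENNReal.toReal_nonneg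
  · rw [(p.apply_eq_zero_iff w).2 hw]
    simp

theorem expect_pure (w : Ω) (F : Ω → ℝ) : (pure w).expect F = F w := by
  classical
  rw [expect, Finset.sum_eq_single w] <;> simp +contextual

theorem expect_bind (p : PMF Ω) (f : Ω → PMF Ω') (F : Ω' → ℝ) :
    (p.bind f).expect F = p.expect fun w => (f w).expect F := by
  simp only [expect, bind_apply, Finset.mul_sum]
  rw [Finset.sum_comm]
  refine Finset.sum_congr rfl fun x _ => ?_
  rw [tsum_fintype, ENNReal.toReal_sum fun w _ => ENNReal.mul_ne_top (p.apply_ne_top w)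
    ((f w).apply_ne_top x), Finset.sum_mul]
  exact Finset.sum_congr rfl fun w _ => by rw [ENNReal.toReal_mul, mul_assoc]

theorem expect_map (p : PMF Ω) (f : Ω → Ω') (F : Ω' → ℝ) :
    (p.map f).expect F = p.expect fun w => F (f w) := by
  rw [← bind_pure_comp, expect_bind]
  simp_rw [Function.comp, expect_pure]

theorem ofReal_expect (p : PMF Ω) {F : Ω → ℝ} (hF : ∀ w, 0 ≤ F w) :
    ENNReal.ofReal (p.expect F) = ∑' w, p w * ENNReal.ofReal (F w) := by
  rw [expect, ENNReal.ofReal_sum_of_nonneg fun w _ => mul_nonneg ENNReal.toReal_nonneg (hF w),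
    tsum_fintype]
  exact Finset.sum_congr rfl fun w _ => by
    rw [ENNReal.ofReal_mul ENNReal.toReal_nonneg, ENNReal.ofReal_toReal (p.apply_ne_top w)]

/-- Every transition law on a finite set has a stationary distribution. -/
theorem exists_stationary [Nonempty Ω] (P : Ω → PMF Ω) : ∃ μ : PMF Ω, μ.bind P = μ := by
  classical
  obtain ⟨w₀⟩ := ‹Nonempty Ω›
  let T : (Ω → ℝ) →ₗ[ℝ] (Ω → ℝ) :=
    { toFun := fun v x => ∑ w, v w * (P w x).toReal
      map_add' := fun v v' => by
        ext x
        simp [add_mul, Finset.sum_add_distrib]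
      map_smul' := fun c v => by
        ext x
        simp [Finset.mul_sum, mul_assoc] }
  have hT : ∀ v ∈ stdSimplex ℝ Ω, T v ∈ stdSimplex ℝ Ω := by
    rintro v ⟨h0, h1⟩
    refine ⟨fun x => Finset.sum_nonneg fun w _ => mul_nonneg (h0 w) ENNReal.toReal_nonneg, ?_⟩
    change ∑ x, ∑ w, v w * (P w x).toReal = 1
    rw [Finset.sum_comm]
    simp_rw [← Finset.mul_sum, sum_toReal, mul_one, h1]
  let v : ℕ → Ω → ℝ := fun n => (T ^ n) (Pi.single w₀ 1)
  have hv : ∀ n, v n ∈ stdSimplex ℝ Ω := by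
    intro n
    induction n with
    | zero => exact single_mem_stdSimplex ℝ w₀
    | succ n ih =>
      have : v (n + 1) = T (v n) := by simp [v, pow_succ']
      rw [this]
      exact hT _ ih
  have hvs : ∀ n, T (v n) = v (n + 1) := fun n => by simp [v, pow_succ']
  -- Krylov–Bogolyubov: Cesàro averages of an orbit are asymptotically invariant, so any limit point
  -- in the compact simplex is stationary.
  let a : ℕ → Ω → ℝ := fun n => ((n : ℝ) + 1)⁻¹ • ∑ k ∈ Finset.range (n + 1), v k
  have ha : ∀ n, a n ∈ stdSimplex ℝ Ω := by
    intro n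
    have : a n = ∑ k ∈ Finset.range (n + 1), ((n : ℝ) + 1)⁻¹ • v k := Finset.smul_sum
    rw [this]
    refine (convex_stdSimplex ℝ Ω).sum_mem (fun _ _ => by positivity) ?_ fun k _ => hv k
    simp
    field_simp
  obtain ⟨μ, hμ, φ, hφ, hlim⟩ := (isCompact_stdSimplex ℝ Ω).tendsto_subseq ha
  have hdiff : ∀ n, T (a n) - a n = ((n : ℝ) + 1)⁻¹ • (v (n + 1) - v 0) := by
    intro n
    simp only [a, map_smul, map_sum, hvs]
    rw [← smul_sub, ← Finset.sum_sub_distrib, Finset.sum_range_sub]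
  have hzero : Filter.Tendsto (fun n => T (a n) - a n) Filter.atTop (nhds 0) := by
    rw [tendsto_pi_nhds]
    intro x
    have hb : ∀ u ∈ stdSimplex ℝ Ω, 0 ≤ u x ∧ u x ≤ 1 := fun u hu =>
      ⟨hu.1 x, hu.2 ▸ Finset.single_le_sum (fun w _ => hu.1 w) (Finset.mem_univ x)⟩
    refine squeeze_zero_norm (a := fun n : ℕ => 1 / ((n : ℝ) + 1)) (fun n => ?_)
      tendsto_one_div_add_atTop_nhds_zero_nat
    rw [hdiff, Pi.smul_apply, Pi.sub_apply, smul_eq_mul, norm_mul, one_div]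
    have h1 := hb _ (hv (n + 1))
    have h2 := hb _ (hv 0)
    have h3 : ‖v (n + 1) x - v 0 x‖ ≤ 1 := by
      rw [Real.norm_eq_abs, abs_le]
      constructor <;> linarith
    have h4 : ‖((n : ℝ) + 1)⁻¹‖ = ((n : ℝ) + 1)⁻¹ := Real.norm_of_nonneg (by positivity)
    rw [h4]
    exact mul_le_of_le_one_right (by positivity) h3
  have hcont : Continuous T := T.continuous_of_finiteDimensional
  have hfix : T μ = μ := by
    have h1 : Filter.Tendsto (fun n => T (a (φ n)) - a (φ n)) Filter.atTop (nhds (T μ - μ)) :=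
      ((hcont.tendsto μ).comp hlim).sub hlim
    exact sub_eq_zero.1 (tendsto_nhds_unique h1 (hzero.comp hφ.tendsto_atTop))
  refine ⟨PMF.ofFintype (fun w => ENNReal.ofReal (μ w)) ?_, ?_⟩
  · rw [← ENNReal.ofReal_sum_of_nonneg fun w _ => hμ.1 w, hμ.2, ENNReal.ofReal_one]
  · ext x
    rw [bind_apply, tsum_fintype]
    simp only [ofFintype_apply]
    have h1 : μ x = ∑ w, μ w * (P w x).toReal := (congrFun hfix x).symm
    rw [h1, ENNReal.ofReal_sum_of_nonneg fun w _ => mul_nonneg (hμ.1 w) ENNReal.toReal_nonneg]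
    exact Finset.sum_congr rfl fun w _ => by
      rw [ENNReal.ofReal_mul (hμ.1 w), ENNReal.ofReal_toReal ((P w).apply_ne_top x)]

end PMF

/-! ### Criteria for recurrence and for its absence -/

namespace MarkovChain

variable {X Ω : Type*}

/-- A nonnegative function that decreases by at least one on average, up to the visit to `y`,
dominates the mean hitting time of `y`. -/
theorem meanHittingTime_le_of_drift (P : X → PMF X) (y : X) (u : X → ℝ≥0∞)
    (hu : ∀ x, 1 + ∑' x', P x x' * (open Classical in if x' = y then 0 else u x') ≤ u x) (x : X) :
    meanHittingTime P x y ≤ u x := by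
  classical
  have key : ∀ n x, ∑ k ∈ Finset.range n, tail P y k x ≤ u x := by
    intro n
    induction n with
    | zero => simp
    | succ n ih =>
      intro x
      rw [Finset.sum_range_succ']
      simp only [tail]
      rw [add_comm]
      refine le_trans (add_le_add le_rfl ?_) (hu x)
      rw [← Summable.tsum_finsetSum fun _ _ => ENNReal.summable]
      refine ENNReal.tsum_le_tsum fun x' => ?_
      rw [← Finset.mul_sum]
      refine mul_le_mul_right ?_ _
      by_cases h : x' = y
      · simp [h]
      · simpa [h] using ih x'
  rw [meanHittingTime, ENNReal.tsum_eq_iSup_nat]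
  exact iSup_le fun n => key n x

theorem tail_succ_le (P : X → PMF X) (y : X) (n : ℕ) (x : X) :
    tail P y (n + 1) x ≤ tail P y n x := by
  classical
  induction n generalizing x with
  | zero =>
    simp only [tail]
    calc ∑' x', P x x' * (if x' = y then 0 else 1) ≤ ∑' x', P x x' * 1 :=
          ENNReal.tsum_le_tsum fun x' => mul_le_mul_right (by split_ifs <;> simp) _
      _ = 1 := by simp [(P x).tsum_coe]
  | succ n ih =>
    rw [tail, tail]
    refine ENNReal.tsum_le_tsum fun x' => mul_le_mul_right ?_ _
    split_ifs
    · exact le_rfl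
    · exact ih x'

theorem tail_antitone (P : X → PMF X) (y x : X) : Antitone fun n => tail P y n x :=
  antitone_nat_of_succ_le fun n => tail_succ_le P y n x

theorem tail_le_one (P : X → PMF X) (y : X) (n : ℕ) (x : X) : tail P y n x ≤ 1 :=
  tail_antitone P y x (Nat.zero_le n)

theorem tail_succ_lt_one {P : X → PMF X} {x y x' : X} (hx' : x' ∈ (P x).support) {n : ℕ}
    (h : x' = y ∨ tail P y n x' < 1) : tail P y (n + 1) x < 1 := by
  classical
  rw [tail, ← (P x).tsum_coe]
  have hle : ∀ z, P x z * (if z = y then 0 else tail P y n z) ≤ P x z := fun z =>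
    mul_le_of_le_one_right zero_le (by split_ifs <;> simp [tail_le_one])
  refine ENNReal.tsum_lt_tsum (i := x') ?_ hle ?_
  · exact ne_top_of_le_ne_top ((P x).tsum_coe ▸ ENNReal.one_ne_top) (ENNReal.tsum_le_tsum hle)
  · have h0 : P x x' ≠ 0 := hx'
    refine lt_of_lt_of_eq (ENNReal.mul_lt_mul_right h0 ((P x).apply_ne_top x') ?_) (mul_one _)
    split_ifs with hy
    · exact one_pos
    · exact h.resolve_left hy

theorem Irreducible.exists_tail_lt_one {P : X → PMF X} (hP : Irreducible P) (x y : X) :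
    ∃ n, tail P y n x < 1 := by
  have key : ∀ z, Relation.ReflTransGen (fun u v => v ∈ (P u).support) z y →
      z = y ∨ ∃ n, tail P y n z < 1 := by
    intro z hz
    induction hz using Relation.ReflTransGen.head_induction_on with
    | refl => exact Or.inl rfl
    | head h _ ih =>
      refine Or.inr ?_
      rcases ih with ih | ⟨n, ih⟩
      · exact ⟨0 + 1, tail_succ_lt_one h (Or.inl ih)⟩
      · exact ⟨n + 1, tail_succ_lt_one h (Or.inr ih)⟩
  -- One step is taken first: for `x = y` the path may be empty, but a return takes at least one
  -- step.
  obtain ⟨x', hx'⟩ := (P x).support_nonempty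
  rcases key x' (hP x' y) with h | ⟨n, h⟩
  · exact ⟨0 + 1, tail_succ_lt_one hx' (Or.inl h)⟩
  · exact ⟨n + 1, tail_succ_lt_one hx' (Or.inr h)⟩

/-- Foster's criterion. -/
theorem Irreducible.meanHittingTime_lt_top {P : X → PMF X} (hP : Irreducible P) {V : X → ℝ≥0∞}
    (hV : ∀ x, V x ≠ ∞) {S : Set X} (hS : S.Finite) {b : ℝ≥0∞} (hb : b ≠ ∞)
    (hd : ∀ x, 1 + ∑' x', P x x' * V x' ≤ V x + S.indicator (fun _ => b) x) (x y : X) :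
    meanHittingTime P x y < ∞ := by
  classical
  choose n hn using fun x => hP.exists_tail_lt_one x y
  obtain ⟨N, hN⟩ : ∃ N, ∀ x ∈ S, tail P y N x < 1 := by
    refine ⟨hS.toFinset.sup n, fun x hx => lt_of_le_of_lt ?_ (hn x)⟩
    exact tail_antitone P y x (Finset.le_sup (f := n) (hS.mem_toFinset.2 hx))
  obtain ⟨C, hC, hCb⟩ : ∃ C : ℝ≥0∞, C ≠ ∞ ∧ ∀ x ∈ S, b ≤ C * (1 - tail P y N x) := by
    refine ⟨∑ x ∈ hS.toFinset, b / (1 - tail P y N x), ?_, fun x hx => ?_⟩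
    · refine ENNReal.sum_ne_top.2 fun x hx => ENNReal.div_ne_top hb ?_
      exact (tsub_pos_of_lt (hN x (hS.mem_toFinset.1 hx))).ne'
    · have h0 : 1 - tail P y N x ≠ 0 := (tsub_pos_of_lt (hN x hx)).ne'
      have h1 : 1 - tail P y N x ≠ ∞ := (tsub_le_self.trans_lt ENNReal.one_lt_top).ne
      calc b = b / (1 - tail P y N x) * (1 - tail P y N x) := (ENNReal.div_mul_cancel h0 h1).symm
        _ ≤ _ := mul_le_mul_left (Finset.single_le_sum
          (f := fun x => b / (1 - tail P y N x)) (fun _ _ => zero_le) (hS.mem_toFinset.2 hx)) _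
  -- `φ` is the mean of the hitting time truncated at `N`. With value 0 at `y`, its drift is `-1 +
  -- tail P y N x`, which is negative on the finite set `S`; the multiple `C * φ` therefore absorbs
  -- `b` there and does no harm elsewhere.
  let φ : X → ℝ≥0∞ := fun x => ∑ k ∈ Finset.range N, tail P y k x
  have hφ : ∀ x, φ x ≠ ∞ := fun x => ENNReal.sum_ne_top.2 fun k _ =>
    ne_top_of_le_ne_top ENNReal.one_ne_top (tail_le_one P y k x)
  have hφd : ∀ x, 1 + ∑' x', P x x' * (if x' = y then 0 else φ x') = φ x + tail P y N x := by
    intro x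
    have h1 : ∑' x', P x x' * (if x' = y then 0 else φ x') =
        ∑ k ∈ Finset.range N, tail P y (k + 1) x := by
      simp only [tail]
      rw [← Summable.tsum_finsetSum fun _ _ => ENNReal.summable]
      refine tsum_congr fun x' => ?_
      rw [← Finset.mul_sum]
      by_cases h : x' = y <;> simp [h, φ]
    rw [h1, ← Finset.sum_range_succ (fun k => tail P y k x), Finset.sum_range_succ', add_comm]
    rfl
  refine lt_of_le_of_lt (meanHittingTime_le_of_drift P y (fun x => V x + C * φ x) (fun x => ?_) x)
    (ENNReal.add_lt_top.2 ⟨(hV x).lt_top, (ENNReal.mul_ne_top hC (hφ x)).lt_top⟩)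
  have h1 : ∑' x', P x x' * (if x' = y then 0 else V x' + C * φ x') ≤
      ∑' x', P x x' * V x' + C * ∑' x', P x x' * (if x' = y then 0 else φ x') := by
    rw [← ENNReal.tsum_mul_left, ← ENNReal.tsum_add]
    refine ENNReal.tsum_le_tsum fun x' => ?_
    split_ifs
    · simp
    · rw [mul_add, mul_left_comm]
  have h2 : C * ∑' x', P x x' * (if x' = y then 0 else φ x') + C * (1 - tail P y N x) ≤
      C * φ x := by
    rw [← mul_add]
    refine mul_le_mul_right ?_ _
    have h3 := hφd x
    have ht : tail P y N x ≠ ∞ := ne_top_of_le_ne_top ENNReal.one_ne_top (tail_le_one P y N x)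
    refine (ENNReal.add_le_add_iff_right ht).1 ?_
    rw [← h3, add_assoc, tsub_add_cancel_of_le (tail_le_one P y N x), add_comm]
  have h4 : S.indicator (fun _ => b) x ≤ C * (1 - tail P y N x) := by
    by_cases hx : x ∈ S
    · simpa [hx] using hCb x hx
    · simp [hx]
  calc _ ≤ 1 + (∑' x', P x x' * V x' + C * ∑' x', P x x' * (if x' = y then 0 else φ x')) :=
        add_le_add le_rfl h1
    _ ≤ V x + S.indicator (fun _ => b) x +
        C * ∑' x', P x x' * (if x' = y then 0 else φ x') := by
      rw [← add_assoc]
      exact add_le_add (hd x) le_rfl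
    _ ≤ V x + (C * ∑' x', P x x' * (if x' = y then 0 else φ x') +
        C * (1 - tail P y N x)) := by
      rw [add_assoc, add_comm (S.indicator _ _)]
      exact add_le_add le_rfl (add_le_add le_rfl h4)
    _ ≤ _ := add_le_add le_rfl h2

variable [Fintype Ω] {P : X → PMF X} {law : X → PMF Ω} {next : X → Ω → X}

theorem Irreducible.meanHittingTime_lt_top_of_expect (hP : Irreducible P)
    (hlaw : ∀ x, P x = (law x).map (next x)) {V : X → ℝ} (hV : ∀ x, 0 ≤ V x) {S : Set X}
    (hS : S.Finite) {b : ℝ} (hb : 0 ≤ b)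
    (hd : ∀ x, (law x).expect (fun w => V (next x w)) + 1 ≤ V x + S.indicator (fun _ => b) x)
    (x y : X) : meanHittingTime P x y < ∞ := by
  refine hP.meanHittingTime_lt_top (V := fun x => ENNReal.ofReal (V x)) (fun _ =>
    ENNReal.ofReal_ne_top) hS (b := ENNReal.ofReal b) ENNReal.ofReal_ne_top (fun x => ?_) x y
  have h1 := ENNReal.ofReal_le_ofReal (hd x)
  have h0 : 0 ≤ S.indicator (fun _ => b) x := Set.indicator_nonneg (fun _ _ => hb) x
  have hE : 0 ≤ (law x).expect fun w => V (next x w) :=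
    Finset.sum_nonneg fun w _ => mul_nonneg ENNReal.toReal_nonneg (hV _)
  rw [ENNReal.ofReal_add hE zero_le_one, ENNReal.ofReal_add (hV x) h0,
    PMF.ofReal_expect _ fun w => hV _, ENNReal.ofReal_one] at h1
  rw [hlaw x, PMF.tsum_map_mul, add_comm]
  refine h1.trans (add_le_add le_rfl ?_)
  by_cases hx : x ∈ S <;> simp [hx]

/-- A function with bounded increments whose mean increments are bounded below by a positive
constant everywhere rules out positive recurrence. -/
theorem not_positiveRecurrentAt_of_drift (hlaw : ∀ x, P x = (law x).map (next x)) {V : X → ℝ}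
    {C ε : ℝ} (hε : 0 < ε) (hC : ∀ x w, V (next x w) ≤ V x + C)
    (hd : ∀ x, V x + ε ≤ (law x).expect fun w => V (next x w)) (y : X) :
    ¬ PositiveRecurrentAt P y := by
  classical
  intro hrec
  let t : ℕ → X → ℝ := fun n x => (tail P y n x).toReal
  have ht0 : ∀ n x, 0 ≤ t n x := fun n x => ENNReal.toReal_nonneg
  have htop : ∀ n x, tail P y n x ≠ ∞ := fun n x =>
    ne_top_of_le_ne_top ENNReal.one_ne_top (tail_le_one P y n x)
  have hts : ∀ n x, t (n + 1) x =
      (law x).expect fun w => if next x w = y then 0 else t n (next x w) := by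
    intro n x
    simp only [t, tail, PMF.expect]
    rw [hlaw x, PMF.tsum_map_mul, tsum_fintype, ENNReal.toReal_sum]
    · refine Finset.sum_congr rfl fun w _ => ?_
      rw [ENNReal.toReal_mul]
      split_ifs <;> simp
    · intro w _
      refine ENNReal.mul_ne_top ((law x).apply_ne_top w) ?_
      split_ifs
      · simp
      · exact htop _ _
  -- `r n x` is the mean of V(X_n) - V(y) on the event τ_y > n. The subtraction of `V y` ensures
  -- that nothing is lost when the chain is stopped at `y`.
  let r : ℕ → X → ℝ := fun n => Nat.rec (fun x => V x - V y)
    (fun _ r x => (law x).expect fun w => if next x w = y then 0 else r (next x w)) n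
  have hr0 : ∀ x, r 0 x = V x - V y := fun _ => rfl
  have hrs : ∀ n x, r (n + 1) x =
      (law x).expect fun w => if next x w = y then 0 else r n (next x w) := fun _ _ => rfl
  have hupper : ∀ n x, r n x ≤ (V x - V y + C * n) * t n x := by
    intro n
    induction n with
    | zero => intro x; simp [hr0, t, tail]
    | succ n ih =>
      intro x
      rw [hrs, hts, ← PMF.expect_const_mul]
      refine PMF.expect_mono _ fun w _ => ?_
      split_ifs
      · simp
      · refine (ih _).trans (mul_le_mul_of_nonneg_right ?_ (ht0 _ _))
        have := hC x w
        push_cast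
        linarith
  have hlower : ∀ n x, V x - V y + ε * ∑ k ∈ Finset.range n, t k x ≤ r n x := by
    intro n
    induction n with
    | zero => intro x; simp [hr0]
    | succ n ih =>
      intro x
      rw [hrs, Finset.sum_range_succ']
      have h1 : (law x).expect (fun w => (V (next x w) - V y) + ε * ∑ k ∈ Finset.range n,
          (if next x w = y then 0 else t k (next x w))) ≤
          (law x).expect fun w => if next x w = y then 0 else r n (next x w) := by
        refine PMF.expect_mono _ fun w _ => ?_
        by_cases h : next x w = y
        · simp [h]
        · simpa [h] using ih (next x w)
      have h2 : (law x).expect (fun w => ∑ k ∈ Finset.range n,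
          (if next x w = y then 0 else t k (next x w))) = ∑ k ∈ Finset.range n, t (k + 1) x := by
        simp_rw [hts, PMF.expect, Finset.mul_sum]
        rw [Finset.sum_comm]
      rw [PMF.expect_add, PMF.expect_sub, PMF.expect_const, PMF.expect_const_mul, h2] at h1
      have h3 : t 0 x = 1 := by simp [t, tail]
      have := hd x
      rw [h3]
      linarith
  have hbound : ∀ n : ℕ, ε ≤ C * ((n : ℝ) + 1) * t (n + 1) y := by
    intro n
    have h1 := (hlower (n + 1) y).trans (hupper (n + 1) y)
    have h3 : t 0 y = 1 := by simp [t, tail]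
    rw [Finset.sum_range_succ', h3] at h1
    have h4 : 0 ≤ ε * ∑ k ∈ Finset.range n, t (k + 1) y :=
      mul_nonneg hε.le (Finset.sum_nonneg fun _ _ => ht0 _ _)
    push_cast at h1
    linarith
  have hCpos : 0 < C := by
    have h1 := hbound 0
    have h2 := ht0 1 y
    by_contra hneg
    have : C * t 1 y ≤ 0 := mul_nonpos_of_nonpos_of_nonneg (not_lt.1 hneg) h2
    simp at h1
    linarith
  -- A finite mean return time makes the tails summable, whereas `hbound` keeps them above a
  -- multiple of the harmonic series.
  have hsum : Summable fun n => t n y := ENNReal.summable_toReal hrec.ne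
  refine Real.not_summable_one_div_natCast ((summable_nat_add_iff 1).1 ?_)
  refine Summable.of_nonneg_of_le (fun n => by positivity) (fun n => ?_)
    (((summable_nat_add_iff 1).2 hsum).mul_left (C / ε))
  have h1 := hbound n
  have h2 : (0 : ℝ) < (n : ℝ) + 1 := by positivity
  push_cast
  rw [div_le_iff₀ h2, div_mul_eq_mul_div, div_mul_eq_mul_div, le_div_iff₀ hε]
  linarith

end MarkovChain

/-! ### Rare events -/

theorem Fintype.sum_fin_three_bool {M : Type*} [AddCommMonoid M] (F : (Fin 3 → Bool) → M) :
    ∑ b, F b = ∑ x : Bool, ∑ y : Bool, ∑ z : Bool, F ![x, y, z] := by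
  rw [← Fintype.sum_prod_type', ← Fintype.sum_prod_type']
  refine (Fintype.sum_bijective (fun t : (Bool × Bool) × Bool => ![t.1.1, t.1.2, t.2])
    (by decide) _ _ fun t => rfl).symm

theorem bernoulliVec_apply_toReal {ι : Type*} [Fintype ι] [DecidableEq ι] (p : ι → unitInterval)
    (b : ι → Bool) : (bernoulliVec p b).toReal = ∏ i, if b i then (p i : ℝ) else 1 - (p i : ℝ) := by
  rw [bernoulliVec, PMF.ofFintype_apply, ENNReal.toReal_prod]
  refine Finset.prod_congr rfl fun i _ => ENNReal.toReal_ofReal ?_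
  split_ifs
  · exact (p i).2.1
  · exact sub_nonneg.2 (p i).2.2

theorem mem_support_bernoulliVec {ι : Type*} [Fintype ι] [DecidableEq ι] {p : ι → unitInterval}
    (hp : ∀ i, 0 < (p i : ℝ) ∧ (p i : ℝ) < 1) (b : ι → Bool) : b ∈ (bernoulliVec p).support := by
  rw [PMF.mem_support_iff]
  intro h
  have h1 := bernoulliVec_apply_toReal p b
  rw [h, ENNReal.toReal_zero] at h1
  refine (Finset.prod_pos fun i _ => ?_).ne h1
  split_ifs
  · exact (hp i).1
  · exact sub_pos.2 (hp i).2

theorem expect_bernoulliVec (p : Fin 3 → unitInterval) (F : (Fin 3 → Bool) → ℝ) :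
    (bernoulliVec p).expect F =
      (1 - p 0) * ((1 - p 1) * ((1 - p 2) * F ![false, false, false] +
        p 2 * F ![false, false, true]) + p 1 * ((1 - p 2) * F ![false, true, false] +
        p 2 * F ![false, true, true])) +
      p 0 * ((1 - p 1) * ((1 - p 2) * F ![true, false, false] +
        p 2 * F ![true, false, true]) + p 1 * ((1 - p 2) * F ![true, true, false] +
        p 2 * F ![true, true, true])) := by
  rw [PMF.expect, Fintype.sum_fin_three_bool]
  simp only [bernoulliVec_apply_toReal, Fin.prod_univ_three, Fintype.sum_bool]
  simp
  ring

/-- A convex combination of two numbers stays close to the first. -/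
theorem abs_mix_sub_le {p u v M : ℝ} (hp : 0 ≤ p) (hu : |u| ≤ M) (hv : |v| ≤ M) :
    |(1 - p) * u + p * v - u| ≤ 2 * M * p := by
  have h : (1 - p) * u + p * v - u = p * (v - u) := by ring
  rw [h, abs_mul, abs_of_nonneg hp, mul_comm]
  refine mul_le_mul_of_nonneg_right ((abs_sub _ _).trans ?_) hp
  linarith

theorem abs_mix_le {p u v M : ℝ} (hp : 0 ≤ p) (hp1 : p ≤ 1) (hu : |u| ≤ M) (hv : |v| ≤ M) :
    |(1 - p) * u + p * v| ≤ M := by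
  rw [abs_le] at *
  constructor <;> nlinarith

theorem abs_expect_le {Ω : Type*} [Fintype Ω] (p : PMF Ω) {F : Ω → ℝ} {M : ℝ}
    (hF : ∀ w, |F w| ≤ M) : |p.expect F| ≤ M := by
  rw [abs_le]
  constructor
  · rw [← p.expect_const (-M)]
    exact p.expect_mono fun w _ => (abs_le.1 (hF w)).1
  · rw [← p.expect_const M]
    exact p.expect_mono fun w _ => (abs_le.1 (hF w)).2

/-- If all probabilities are at most `θ`, then up to `O(θ)` no event occurs. -/
theorem abs_expect_sub_le {p : Fin 3 → unitInterval} {θ M : ℝ} (hp : ∀ i, (p i : ℝ) ≤ θ)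
    {F : (Fin 3 → Bool) → ℝ} (hF : ∀ b, |F b| ≤ M) :
    |(bernoulliVec p).expect F - F ![false, false, false]| ≤ 6 * M * θ := by
  have hM : 0 ≤ M := (abs_nonneg _).trans (hF ![false, false, false])
  have h0 := fun i => (p i).2.1
  have h1 := fun i => (p i).2.2
  rw [expect_bernoulliVec]
  have a1 := abs_mix_sub_le (h0 2) (hF ![false, false, false]) (hF ![false, false, true])
  have a2 := abs_mix_le (h0 2) (h1 2) (hF ![false, false, false]) (hF ![false, false, true])
  have a3 := abs_mix_le (h0 2) (h1 2) (hF ![false, true, false]) (hF ![false, true, true])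
  have a4 := abs_mix_le (h0 2) (h1 2) (hF ![true, false, false]) (hF ![true, false, true])
  have a5 := abs_mix_le (h0 2) (h1 2) (hF ![true, true, false]) (hF ![true, true, true])
  have b1 := abs_mix_sub_le (h0 1) a2 a3
  have b2 := abs_mix_le (h0 1) (h1 1) a2 a3
  have b3 := abs_mix_le (h0 1) (h1 1) a4 a5
  have c1 := abs_mix_sub_le (h0 0) b2 b3
  have e0 := mul_le_mul_of_nonneg_left (hp 0) hM
  have e1 := mul_le_mul_of_nonneg_left (hp 1) hM
  have e2 := mul_le_mul_of_nonneg_left (hp 2) hM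
  rw [abs_le] at a1 b1 c1 ⊢
  constructor <;> linarith

/-- If all probabilities are at most `θ`, then up to `O(θ²)` at most one event occurs. -/
theorem abs_expect_sub_first_order_le {p : Fin 3 → unitInterval} {θ M : ℝ}
    (hp : ∀ i, (p i : ℝ) ≤ θ) {F : (Fin 3 → Bool) → ℝ} (hF : ∀ b, |F b| ≤ M) :
    |(bernoulliVec p).expect F - (F ![false, false, false] +
      (p 0 * (F ![true, false, false] - F ![false, false, false]) +
       p 1 * (F ![false, true, false] - F ![false, false, false]) +
       p 2 * (F ![false, false, true] - F ![false, false, false])))| ≤ 20 * M * θ ^ 2 := by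
  have hM : 0 ≤ M := (abs_nonneg _).trans (hF ![false, false, false])
  have h0 := fun i => (p i).2.1
  have hθ : 0 ≤ θ := (h0 0).trans (hp 0)
  rw [expect_bernoulliVec]
  have f000 := abs_le.1 (hF ![false, false, false])
  have f100 := abs_le.1 (hF ![true, false, false])
  have f010 := abs_le.1 (hF ![false, true, false])
  have f001 := abs_le.1 (hF ![false, false, true])
  have f110 := abs_le.1 (hF ![true, true, false])
  have f101 := abs_le.1 (hF ![true, false, true])
  have f011 := abs_le.1 (hF ![false, true, true])
  have f111 := abs_le.1 (hF ![true, true, true])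
  have hpp : ∀ i j, (p i : ℝ) * p j ≤ θ ^ 2 := fun i j => by
    rw [sq]
    exact mul_le_mul (hp i) (hp j) (h0 j) hθ
  have bnd : ∀ (q x N : ℝ), 0 ≤ q → q ≤ θ ^ 2 → |x| ≤ N → |q * x| ≤ N * θ ^ 2 := by
    intro q x N hq hq' hx
    rw [abs_mul, abs_of_nonneg hq, mul_comm]
    exact mul_le_mul hx hq' hq ((abs_nonneg x).trans hx)
  -- The remainder consists of the products of two or three probabilities; their coefficients are
  -- the mixed differences of `F`.
  have k01 := bnd (p 0 * p 1) (F ![true, true, false] - F ![true, false, false] -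
    F ![false, true, false] + F ![false, false, false]) (4 * M) (mul_nonneg (h0 0) (h0 1))
    (hpp 0 1) (by rw [abs_le]; constructor <;> linarith)
  have k02 := bnd (p 0 * p 2) (F ![true, false, true] - F ![true, false, false] -
    F ![false, false, true] + F ![false, false, false]) (4 * M) (mul_nonneg (h0 0) (h0 2))
    (hpp 0 2) (by rw [abs_le]; constructor <;> linarith)
  have k12 := bnd (p 1 * p 2) (F ![false, true, true] - F ![false, true, false] -
    F ![false, false, true] + F ![false, false, false]) (4 * M) (mul_nonneg (h0 1) (h0 2))
    (hpp 1 2) (by rw [abs_le]; constructor <;> linarith)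
  have k012 := bnd (p 0 * p 1 * p 2) (F ![true, true, true] - F ![true, true, false] -
    F ![true, false, true] - F ![false, true, true] + F ![true, false, false] +
    F ![false, true, false] + F ![false, false, true] - F ![false, false, false]) (8 * M)
    (mul_nonneg (mul_nonneg (h0 0) (h0 1)) (h0 2))
    ((mul_le_of_le_one_right (mul_nonneg (h0 0) (h0 1)) (p 2).2.2).trans (hpp 0 1))
    (by rw [abs_le]; constructor <;> linarith)
  rw [abs_le] at k01 k02 k12 k012 ⊢
  constructor <;> linarith

namespace ThreeQueue

theorem coe_toProb {x : ℝ} (h0 : 0 ≤ x) (h1 : x ≤ 1) : (toProb x : ℝ) = x := by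
  rw [toProb, Set.projIcc_of_mem zero_le_one ⟨h0, h1⟩]

/-- The laws of the decoherence events, the server arrivals and the request arrivals. -/
noncomputable def decoherenceLaw (h : ℝ) : PMF (Fin 3 → Bool) :=
  bernoulliVec fun i => toProb (decoherence h i)

noncomputable def serverLaw (h : ℝ) : PMF (Fin 3 → Bool) :=
  bernoulliVec fun i => toProb ((![20, 200, 200] : Fin 3 → ℝ) i * h)

noncomputable def requestLaw (h : ℝ) : PMF (Fin 3 → Bool) :=
  bernoulliVec (arrivals ![4, 150, 150] h)

theorem coe_decoherence {h : ℝ} (h0 : 0 < h) (h1 : h ≤ 1 / 200) (i : Fin 3) :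
    (toProb (decoherence h i) : ℝ) = decoherence h i := by
  have : h ^ 2 ≤ 1 := by nlinarith
  fin_cases i
  · exact coe_toProb (by simpa [decoherence] using this) (by simp [decoherence]; positivity)
  · exact coe_toProb (by simp [decoherence]; positivity) (by simpa [decoherence] using this)
  · exact coe_toProb (by simp [decoherence]; positivity) (by simpa [decoherence] using this)

theorem coe_servers {h : ℝ} (h0 : 0 < h) (h1 : h ≤ 1 / 200) (i : Fin 3) :
    (toProb ((![20, 200, 200] : Fin 3 → ℝ) i * h) : ℝ) = (![20, 200, 200] : Fin 3 → ℝ) i * h := by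
  fin_cases i <;> exact coe_toProb (by simp; linarith) (by simp; linarith)

theorem coe_arrivals {h : ℝ} (h0 : 0 < h) (h1 : h ≤ 1 / 200) (i : Fin 3) :
    (arrivals ![4, 150, 150] h i : ℝ) = (![4, 150, 150] : Fin 3 → ℝ) i * h := by
  fin_cases i <;> exact coe_toProb (by simp; linarith) (by simp; linarith)

/-- In a typical slot the type-0 server decoheres and the other two survive; each deviation from
this has probability h². -/
theorem abs_expect_decoherence_sub_le {h : ℝ} (h0 : 0 < h) (h1 : h ≤ 1 / 200) {M : ℝ}
    {F : (Fin 3 → Bool) → ℝ} (hF : ∀ b, |F b| ≤ M) :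
    |(decoherenceLaw h).expect F - F ![true, false, false]| ≤ 6 * M * h ^ 2 := by
  have hM : 0 ≤ M := (abs_nonneg _).trans (hF ![false, false, false])
  have hq0 : 0 ≤ h ^ 2 := by positivity
  have hq1 : h ^ 2 ≤ 1 := by nlinarith
  rw [decoherenceLaw, expect_bernoulliVec]
  simp only [coe_decoherence h0 h1]
  simp only [decoherence, Matrix.cons_val]
  have a2 := abs_mix_le hq0 hq1 (hF ![false, false, false]) (hF ![false, false, true])
  have a3 := abs_mix_le hq0 hq1 (hF ![false, true, false]) (hF ![false, true, true])
  have a1 := abs_mix_sub_le hq0 (hF ![true, false, false]) (hF ![true, false, true])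
  have a4 := abs_mix_le hq0 hq1 (hF ![true, false, false]) (hF ![true, false, true])
  have a5 := abs_mix_le hq0 hq1 (hF ![true, true, false]) (hF ![true, true, true])
  have b1 := abs_mix_sub_le hq0 a4 a5
  have b2 := abs_mix_le hq0 hq1 a2 a3
  have b3 := abs_mix_le hq0 hq1 a4 a5
  have c1 := abs_mix_sub_le hq0 b3 b2
  have e : (1 - (1 - h ^ 2)) = h ^ 2 := by ring
  rw [e]
  rw [abs_le] at a1 b1 c1 ⊢
  constructor <;> linarith

/-- First order expansion of the mean of a function of the random events of a slot. -/
theorem le_expect_events {h : ℝ} (h0 : 0 < h) (h1 : h ≤ 1 / 200) {M : ℝ}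
    {G : (Fin 3 → Bool) → (Fin 3 → Bool) → (Fin 3 → Bool) → ℝ} (hG : ∀ d b c, |G d b c| ≤ M)
    (hzero : G ![true, false, false] ![false, false, false] ![false, false, false] = 0) :
    h * (20 * G ![true, false, false] ![true, false, false] ![false, false, false] +
      200 * G ![true, false, false] ![false, true, false] ![false, false, false] +
      200 * G ![true, false, false] ![false, false, true] ![false, false, false] +
      4 * G ![true, false, false] ![false, false, false] ![true, false, false] +
      150 * G ![true, false, false] ![false, false, false] ![false, true, false] +
      150 * G ![true, false, false] ![false, false, false] ![false, false, true]) -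
      3000000 * M * h ^ 2 ≤
    (decoherenceLaw h).expect fun d => (serverLaw h).expect fun b =>
      (requestLaw h).expect fun c => G d b c := by
  have hM : 0 ≤ M := (abs_nonneg _).trans (hG ![true, false, false] ![false, false, false]
    ![false, false, false])
  have hp : ∀ i, (toProb ((![20, 200, 200] : Fin 3 → ℝ) i * h) : ℝ) ≤ 200 * h := fun i => by
    rw [coe_servers h0 h1]
    fin_cases i <;> simp <;> linarith
  have hl : ∀ i, (arrivals ![4, 150, 150] h i : ℝ) ≤ 200 * h := fun i => by
    rw [coe_arrivals h0 h1]
    fin_cases i <;> simp <;> linarith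
  -- The errors, in units of M h²: 6 for decoherence, 2 · 20 · 200² for the two expansions, and 2 ·
  -- 420 · 6 · 200 for ignoring requests in slots with a server arrival. Their sum is below 3000000.
  have a1 := abs_expect_decoherence_sub_le h0 h1
    (fun d => abs_expect_le (serverLaw h) (fun b => abs_expect_le (requestLaw h) (hG d b)))
  have a2 := abs_expect_sub_first_order_le hp
    (fun b => abs_expect_le (requestLaw h) (hG ![true, false, false] b))
  have a3 := abs_expect_sub_first_order_le hl
    (hG ![true, false, false] ![false, false, false])
  have a4 := abs_expect_sub_le hl (hG ![true, false, false] ![true, false, false])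
  have a5 := abs_expect_sub_le hl (hG ![true, false, false] ![false, true, false])
  have a6 := abs_expect_sub_le hl (hG ![true, false, false] ![false, false, true])
  have a7 := abs_expect_sub_le hl (hG ![true, false, false] ![false, false, false])
  simp only [coe_servers h0 h1, coe_arrivals h0 h1] at a2 a3
  simp only [Matrix.cons_val] at a2 a3
  rw [hzero] at a3 a7
  simp only [serverLaw, requestLaw] at a1 a2 ⊢
  rw [abs_le] at a1 a2 a3 a4 a5 a6 a7
  have a4' := mul_le_mul_of_nonneg_left a4.1 h0.le
  have a5' := mul_le_mul_of_nonneg_left a5.1 h0.le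
  have a6' := mul_le_mul_of_nonneg_left a6.1 h0.le
  have a7' := mul_le_mul_of_nonneg_left a7.2 h0.le
  have hMh : 0 ≤ M * h ^ 2 := by positivity
  linarith

/-! ### The transitions of the network -/

abbrev State := MDPN.State (Fin 3) Memory

/-- The state after the service in a slot, before decoherence and arrivals. -/
def served (a : Action) (x : State) : State :=
  (fun r => x.1 r - if r ∈ scheduled a x.2 then 1 else 0, fun i => x.2 i && !used a x.2 i)

/-- The effect of decoherence `d`, server arrivals `b` and request arrivals `c`. -/
def transit (y : State) (d b c : Fin 3 → Bool) : State :=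
  (fun r => y.1 r + (c r).toNat, fun i => (y.2 i && !d i) || b i)

/-- The law of all random choices in a slot. -/
noncomputable def slotLaw (h : ℝ) (q : PMF Action) :
    PMF (Action × (Fin 3 → Bool) × (Fin 3 → Bool) × (Fin 3 → Bool)) :=
  q.bind fun a => (decoherenceLaw h).bind fun d => (serverLaw h).bind fun b =>
    (requestLaw h).map fun c => (a, d, b, c)

def slotNext (x : State) (w : Action × (Fin 3 → Bool) × (Fin 3 → Bool) × (Fin 3 → Bool)) : State :=
  transit (served w.1 x) w.2.1 w.2.2.1 w.2.2.2

theorem expect_slotLaw (h : ℝ) (q : PMF Action)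
    (F : Action × (Fin 3 → Bool) × (Fin 3 → Bool) × (Fin 3 → Bool) → ℝ) :
    (slotLaw h q).expect F = q.expect fun a => (decoherenceLaw h).expect fun d =>
      (serverLaw h).expect fun b => (requestLaw h).expect fun c => F (a, d, b, c) := by
  simp only [slotLaw, PMF.expect_bind, PMF.expect_map]

/-- The chain of the network. -/
noncomputable abbrev netChain (h : ℝ) (π : MDPN.Policy (Fin 3) Memory Action) : State → PMF State :=
  (network ![20, 200, 200] h).chain (arrivals ![4, 150, 150] h) π

theorem netChain_eq (h : ℝ) (π : MDPN.Policy (Fin 3) Memory Action) (x : State) :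
    netChain h π x = (slotLaw h (π x)).map (slotNext x) := by
  simp only [netChain, MDPN.chain, network, slotLaw, PMF.map_bind, PMF.bind_bind, PMF.bind_map,
    PMF.map_comp, decoherenceLaw, serverLaw, requestLaw]
  rfl

/-- The schedule is a deterministic function of action and memory, blind to queue lengths. -/
theorem meanService_eq (h : ℝ) (a : Action) (z : Memory) (r : Fin 3) :
    (network ![20, 200, 200] h).meanService a z r = if r ∈ scheduled a z then 1 else 0 := by
  change ((network ![20, 200, 200] h).kernel a z).expect
    (fun y => ((if r ∈ y.2 then 1 else 0 : ℕ) : ℝ)) = _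
  simp only [network, PMF.expect_bind, PMF.expect_map]
  have key : ∀ (p q : PMF (Fin 3 → Bool)) (c : ℝ), p.expect (fun _ => q.expect fun _ => c) = c := by
    intro p q c
    rw [PMF.expect_const, PMF.expect_const]
  refine (key _ _ _).trans ?_
  split_ifs <;> simp

theorem zero_mem_scheduled {a : Action} {z : Memory} :
    0 ∈ scheduled a z ↔ a = .serve0 ∧ z 0 = true ∧ z 1 = true ∧ z 2 = true := by
  cases a <;> simp [scheduled, Action.requests, needs, Fin.forall_fin_succ]

theorem one_mem_scheduled {a : Action} {z : Memory} :
    1 ∈ scheduled a z ↔ (a = .serve1 ∨ a = .serve12) ∧ z 1 = true := by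
  rw [scheduled, Finset.mem_filter]
  cases a <;> simp [Action.requests, needs]

theorem two_mem_scheduled {a : Action} {z : Memory} :
    2 ∈ scheduled a z ↔ (a = .serve2 ∨ a = .serve12) ∧ z 2 = true := by
  rw [scheduled, Finset.mem_filter]
  cases a <;> simp [Action.requests, needs]

theorem used_zero (a : Action) (z : Memory) : used a z 0 = decide (0 ∈ scheduled a z) := by
  simp [used, needs, Fin.exists_fin_succ]

theorem used_one (a : Action) (z : Memory) :
    used a z 1 = (decide (0 ∈ scheduled a z) || decide (1 ∈ scheduled a z)) := by
  simp [used, needs, Fin.exists_fin_succ]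

theorem used_two (a : Action) (z : Memory) :
    used a z 2 = (decide (0 ∈ scheduled a z) || decide (2 ∈ scheduled a z)) := by
  simp [used, needs, Fin.exists_fin_succ]

theorem exists_eq_vec {α : Type*} (q : Fin 3 → α) : ∃ a b c, q = ![a, b, c] :=
  ⟨q 0, q 1, q 2, by ext i; fin_cases i <;> rfl⟩

/-! ### Instability under MaxWeight -/

/-- A function of the state that increases on average under MaxWeight. -/
noncomputable def potential (x : State) : ℝ :=
  -- The weight 7/200 leaves drift 4 - (7/200) · 100 = 1/2 when neither server is stored. The term
  -- 3/100 is a reserve spent when a request breaks up a waiting pair. The last term charges a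
  -- type-0 service already when the type-0 server arrives.
  x.1 0 + 7 / 200 * (x.1 1 - (if x.2 1 then 1 else 0) + (x.1 2 - (if x.2 2 then 1 else 0))) -
    3 / 100 * (if x.1 1 = 0 ∧ x.1 2 = 0 ∧ x.2 1 ∧ x.2 2 then 1 else 0) -
    (if x.2 0 ∧ x.2 1 ∧ x.2 2 then 1 else 0)

theorem potential_le (x : State) :
    potential x ≤ x.1 0 + 7 / 200 * (x.1 1 + x.1 2) := by
  rw [potential]
  split_ifs <;> linarith

theorem le_potential (x : State) :
    x.1 0 + 7 / 200 * (x.1 1 + x.1 2) - 2 ≤ potential x := by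
  rw [potential]
  split_ifs <;> linarith

theorem transit_queue_bounds (y : State) (d b c : Fin 3 → Bool) (r : Fin 3) :
    (y.1 r : ℝ) ≤ (transit y d b c).1 r ∧ ((transit y d b c).1 r : ℝ) ≤ y.1 r + 1 := by
  simp only [transit]
  cases c r <;> simp

theorem served_queue_bounds (a : Action) (x : State) (r : Fin 3) :
    (x.1 r : ℝ) - 1 ≤ (served a x).1 r ∧ ((served a x).1 r : ℝ) ≤ x.1 r := by
  rw [sub_le_iff_le_add]
  simp only [served]
  norm_cast
  constructor <;> split_ifs <;> omega

theorem abs_potential_transit_sub_le (y : State) (d b c d' b' c' : Fin 3 → Bool) :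
    |potential (transit y d b c) - potential (transit y d' b' c')| ≤ 5 := by
  have h1 := potential_le (transit y d b c)
  have h2 := le_potential (transit y d b c)
  have h3 := potential_le (transit y d' b' c')
  have h4 := le_potential (transit y d' b' c')
  have k := transit_queue_bounds y d b c
  have k' := transit_queue_bounds y d' b' c'
  rw [abs_le]
  constructor <;> linarith [k 0, k 1, k 2, k' 0, k' 1, k' 2]

theorem potential_slotNext_le (x : State)
    (w : Action × (Fin 3 → Bool) × (Fin 3 → Bool) × (Fin 3 → Bool)) :
    potential (slotNext x w) ≤ potential x + 5 := by
  have h1 := potential_le (slotNext x w)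
  have h2 := le_potential x
  have k := served_queue_bounds w.1 x
  have k' := transit_queue_bounds (served w.1 x) w.2.1 w.2.2.1 w.2.2.2
  rw [slotNext] at h1 ⊢
  linarith [k 0, k 1, k 2, k' 0, k' 1, k' 2]

/-- Service does not decrease the potential. -/
theorem potential_le_served (a : Action) (x : State) :
    potential x ≤ potential
      (transit (served a x) ![true, false, false] ![false, false, false] ![false, false, false]) := by
  obtain ⟨q, z⟩ := x
  obtain ⟨m, k, l, rfl⟩ := exists_eq_vec q
  obtain ⟨z0, z1, z2, rfl⟩ := exists_eq_vec z
  simp only [potential, transit, served, used_one, used_two, zero_mem_scheduled,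
    one_mem_scheduled, two_mem_scheduled, Matrix.cons_val]
  have hm : (m : ℝ) - 1 ≤ (m - 1 : ℕ) := by rw [sub_le_iff_le_add]; norm_cast; omega
  have hk : (k : ℝ) - 1 ≤ (k - 1 : ℕ) := by rw [sub_le_iff_le_add]; norm_cast; omega
  have hl : (l : ℝ) - 1 ≤ (l - 1 : ℕ) := by rw [sub_le_iff_le_add]; norm_cast; omega
  cases a <;> cases z1 <;> cases z2 <;> cases z0 <;> simp <;> (try split_ifs) <;> linarith

/-- Under MaxWeight no server of type 1 or 2 is left unused while the queue of the same type is
nonempty. -/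
theorem served_of_isMaxWeight {h : ℝ} {π : MDPN.Policy (Fin 3) Memory Action}
    (hπ : (network ![20, 200, 200] h).IsMaxWeight π) {x : State} {a : Action}
    (ha : a ∈ (π x).support) :
    ((served a x).2 1 = true → (served a x).1 1 = 0) ∧
      ((served a x).2 2 = true → (served a x).1 2 = 0) := by
  obtain ⟨q, z⟩ := x
  obtain ⟨m, k, l, rfl⟩ := exists_eq_vec q
  obtain ⟨z0, z1, z2, rfl⟩ := exists_eq_vec z
  have h1 := hπ _ _ a ha
  simp only [meanService_eq, Fin.sum_univ_three, zero_mem_scheduled, one_mem_scheduled,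
    two_mem_scheduled, Matrix.cons_val] at h1
  simp only [served, used_one, used_two, zero_mem_scheduled, one_mem_scheduled,
    two_mem_scheduled, Matrix.cons_val]
  -- Three competitors suffice: also using an idle server for its own queue would add that queue's
  -- length to the weight.
  have s1 := h1 .serve1
  have s2 := h1 .serve2
  have s3 := h1 .serve12
  clear h1 ha hπ
  have hp : ∀ n : ℕ, (0 : ℝ) ≤ n := fun n => n.cast_nonneg
  have p1 := hp k
  have p2 := hp l
  revert s1 s2 s3 p1 p2
  cases a <;> cases z0 <;> cases z1 <;> cases z2 <;> simp <;> intros <;>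
    (try constructor) <;> (rw [← Nat.cast_eq_zero (R := ℝ)]) <;> linarith

/-- The mean effect of the arrivals on the potential. -/
theorem potential_arrivals {y : State} (h1 : y.2 1 = true → y.1 1 = 0)
    (h2 : y.2 2 = true → y.1 2 = 0) {V : (Fin 3 → Bool) → (Fin 3 → Bool) → ℝ}
    (hV : ∀ b c, V b c = potential (transit y ![true, false, false] b c) -
      potential (transit y ![true, false, false] ![false, false, false] ![false, false, false])) :
    1 / 2 ≤ 20 * V ![true, false, false] ![false, false, false] +
      200 * V ![false, true, false] ![false, false, false] +
      200 * V ![false, false, true] ![false, false, false] +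
      4 * V ![false, false, false] ![true, false, false] +
      150 * V ![false, false, false] ![false, true, false] +
      150 * V ![false, false, false] ![false, false, true] := by
  obtain ⟨q, z⟩ := y
  obtain ⟨m, k, l, rfl⟩ := exists_eq_vec q
  obtain ⟨z0, z1, z2, rfl⟩ := exists_eq_vec z
  simp only [hV, potential, transit, Matrix.cons_val]
  simp only [Matrix.cons_val] at h1 h2
  -- The drift is 1/2 with no server stored. With one stored it is 15/2, or 15/2 - 200 · 3/100 = 3/2
  -- if the other queue is empty too. With both stored it is 4 + 300 · (7/200 + 3/100) - 20 = 7/2.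
  rcases k with _ | k <;> rcases l with _ | l <;> cases z1 <;> cases z2 <;>
    simp at h1 h2 <;> norm_num <;> linarith

theorem potential_drift {h : ℝ} (h0 : 0 < h) (h1 : h ≤ 1 / 100000000)
    {π : MDPN.Policy (Fin 3) Memory Action} (hπ : (network ![20, 200, 200] h).IsMaxWeight π)
    (x : State) :
    potential x + h / 4 ≤ (slotLaw h (π x)).expect fun w => potential (slotNext x w) := by
  rw [expect_slotLaw]
  rw [← (π x).expect_const (potential x + h / 4)]
  refine (π x).expect_mono fun a ha => ?_
  obtain ⟨k1, k2⟩ := served_of_isMaxWeight hπ ha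
  have e1 := le_expect_events h0 (by linarith) (G := fun d b c =>
    potential (transit (served a x) d b c) - potential (transit (served a x)
      ![true, false, false] ![false, false, false] ![false, false, false]))
    (fun d b c => abs_potential_transit_sub_le _ _ _ _ _ _ _) (sub_self _)
  have e2 := potential_arrivals k1 k2 (V := fun b c =>
    potential (transit (served a x) ![true, false, false] b c) - potential (transit (served a x)
      ![true, false, false] ![false, false, false] ![false, false, false])) fun _ _ => rfl
  have e3 := potential_le_served a x
  simp only [PMF.expect_sub, PMF.expect_const] at e1
  have e4 := mul_le_mul_of_nonneg_left e2 h0.le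
  simp only [slotNext]
  have e5 : 15000000 * h ^ 2 ≤ h / 4 := by nlinarith
  linarith

theorem not_positiveRecurrentAt_of_isMaxWeight {h : ℝ} (h0 : 0 < h) (h1 : h ≤ 1 / 100000000)
    {π : MDPN.Policy (Fin 3) Memory Action} (hπ : (network ![20, 200, 200] h).IsMaxWeight π)
    (x : State) : ¬ MarkovChain.PositiveRecurrentAt (netChain h π) x :=
  MarkovChain.not_positiveRecurrentAt_of_drift (netChain_eq h π) (ε := h / 4) (by positivity)
    potential_slotNext_le (potential_drift h0 h1 hπ) x

/-! ### Stability under the policy P0 -/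

/-- The action of the policy P0. -/
def priorityAction (x : State) : Action :=
  if 0 < x.1 0 then .serve0
  else if 0 < x.1 1 then (if 0 < x.1 2 then .serve12 else .serve1)
  else if 0 < x.1 2 then .serve2 else .idle

theorem priorityZero_eq (x : State) : priorityZero x = PMF.pure (priorityAction x) := rfl

/-- The state after service under the policy P0. -/
def priorityServed (x : State) : State := served (priorityAction x) x

theorem mem_support_netChain {h : ℝ} (h0 : 0 < h) (h1 : h < 1 / 200) (x : State)
    (d b c : Fin 3 → Bool) :
    transit (priorityServed x) d b c ∈ (netChain h priorityZero x).support := by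
  have hd : d ∈ (decoherenceLaw h).support := mem_support_bernoulliVec (fun i => by
    rw [coe_decoherence h0 h1.le]
    have p0 : 0 < h ^ 2 := by positivity
    have p1 : h ^ 2 < 1 := by nlinarith
    fin_cases i
    · exact ⟨sub_pos.2 p1, sub_lt_self _ p0⟩
    · exact ⟨p0, p1⟩
    · exact ⟨p0, p1⟩) d
  have hb : b ∈ (serverLaw h).support := mem_support_bernoulliVec (fun i => by
    rw [coe_servers h0 h1.le]
    fin_cases i <;> simp <;> constructor <;> linarith) b
  have hc : c ∈ (requestLaw h).support := mem_support_bernoulliVec (fun i => by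
    rw [coe_arrivals h0 h1.le]
    fin_cases i <;> simp <;> constructor <;> linarith) c
  rw [netChain_eq, PMF.mem_support_map_iff]
  refine ⟨(priorityAction x, d, b, c), ?_, rfl⟩
  rw [priorityZero_eq, slotLaw, PMF.pure_bind]
  simp only [PMF.mem_support_bind_iff, PMF.mem_support_map_iff]
  exact ⟨d, hd, b, hb, c, hc, rfl⟩

/-- Total decoherence has positive probability, and server arrivals then set the memory at will.
This makes irreducibility easy. -/
theorem transit_decohere_all (y : State) (b c : Fin 3 → Bool) :
    transit y (fun _ => true) b c = (fun r => y.1 r + (c r).toNat, b) := by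
  simp [transit]

theorem priorityServed_empty_memory (q : Fin 3 → ℕ) :
    priorityServed (q, fun _ => false) = (q, fun _ => false) := by
  ext i
  · fin_cases i <;>
      simp [priorityServed, served, zero_mem_scheduled, one_mem_scheduled, two_mem_scheduled]
  · simp [priorityServed, served]

theorem priorityServed_full_memory {q : Fin 3 → ℕ} (hq : q ≠ 0) :
    ∑ r, (priorityServed (q, fun _ => true)).1 r < ∑ r, q r := by
  obtain ⟨m, k, l, rfl⟩ := exists_eq_vec q
  rcases m with _ | m <;> rcases k with _ | k <;> rcases l with _ | l <;>
    simp [priorityServed, served, zero_mem_scheduled, one_mem_scheduled, two_mem_scheduled,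
      priorityAction, Fin.sum_univ_three] at hq ⊢ <;> omega

/-- With the memory kept full and no arrivals, P0 drains all queues; with the memory kept empty,
nothing is served and any queue vector is built up one request at a time. -/
theorem irreducible_priorityZero {h : ℝ} (h0 : 0 < h) (h1 : h < 1 / 200) :
    MarkovChain.Irreducible (netChain h priorityZero) := by
  have step : ∀ (x : State) (b c : Fin 3 → Bool),
      (fun r => (priorityServed x).1 r + (c r).toNat, b) ∈ (netChain h priorityZero x).support :=
    fun x b c => transit_decohere_all (priorityServed x) b c ▸
      mem_support_netChain h0 h1 x (fun _ => true) b c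
  have step0 : ∀ (x : State) (b : Fin 3 → Bool),
      ((priorityServed x).1, b) ∈ (netChain h priorityZero x).support :=
    fun x b => by simpa using step x b fun _ => false
  have down : ∀ (n : ℕ) (q : Fin 3 → ℕ), ∑ r, q r = n →
      Relation.ReflTransGen (fun u v => v ∈ (netChain h priorityZero u).support)
        (q, fun _ => true) (0, fun _ => false) := by
    intro n
    induction n using Nat.strong_induction_on with
    | _ n ih =>
      intro q hq
      by_cases hq0 : q = 0
      · subst hq0
        refine Relation.ReflTransGen.single ?_
        convert step0 (0, fun _ => true) (fun _ => false) using 2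
        ext r
        simp [priorityServed, served]
      · refine Relation.ReflTransGen.head (step0 (q, fun _ => true) (fun _ => true)) ?_
        exact ih _ (hq ▸ priorityServed_full_memory hq0) _ rfl
  have up : ∀ (n : ℕ) (q : Fin 3 → ℕ), ∑ r, q r = n →
      Relation.ReflTransGen (fun u v => v ∈ (netChain h priorityZero u).support)
        (0, fun _ => false) (q, fun _ => false) := by
    intro n
    induction n with
    | zero =>
      intro q hq
      have : q = 0 := by
        ext r
        exact Finset.sum_eq_zero_iff.1 hq r (Finset.mem_univ r)
      rw [this]
    | succ n ih =>
      intro q hq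
      obtain ⟨i, hi⟩ : ∃ i, q i ≠ 0 := by
        by_contra! hcon
        simp [hcon] at hq
      have hupd : ∀ r, Function.update q i (q i - 1) r + (decide (r = i)).toNat = q r := by
        intro r
        by_cases hr : r = i
        · subst hr
          simp
          omega
        · simp [hr]
      refine Relation.ReflTransGen.tail (ih (Function.update q i (q i - 1)) ?_) ?_
      · have h2 : ∑ r, (Function.update q i (q i - 1) r + (decide (r = i)).toNat) = n + 1 := by
          rw [← hq]
          exact Finset.sum_congr rfl fun r _ => hupd r
        rw [Finset.sum_add_distrib] at h2
        have h3 : ∑ r, (decide (r = i)).toNat = 1 := by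
          rw [Finset.sum_eq_single i] <;> simp +contextual
        omega
      · have h2 := step (Function.update q i (q i - 1), fun _ => false) (fun _ => false)
          (fun r => decide (r = i))
        rw [priorityServed_empty_memory] at h2
        simpa only [hupd] using h2
  intro x y
  have e1 : Relation.ReflTransGen (fun u v => v ∈ (netChain h priorityZero u).support)
      (y.1, fun _ => false) y := by
    refine Relation.ReflTransGen.single ?_
    have h2 := step0 (y.1, fun _ => false) y.2
    rwa [priorityServed_empty_memory] at h2
  exact ((Relation.ReflTransGen.single (step0 x fun _ => true)).trans (down _ _ rfl)).trans
    ((up _ _ rfl).trans e1)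

/-- The expected work in front of queue `j`, after service. -/
noncomputable def workload (j : Fin 3) (y : State) : ℝ :=
  -- Time is counted in interarrival times 1/200 of a server j: 23/2 = 1/2 + 1 + 10 for the first
  -- stored server, its partner and the type-0 server. The subtracted credit is 1/2 with one server
  -- stored and 3/2 with both.
  23 / 2 * y.1 0 + y.1 j - if y.1 0 = 0 then 0 else
    ((if y.2 1 then 1 / 2 else 0) + (if y.2 2 then 1 / 2 else 0) +
      if y.2 1 && y.2 2 then 1 / 2 else 0)

theorem workload_le (j : Fin 3) (y : State) : workload j y ≤ 23 / 2 * y.1 0 + y.1 j := by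
  rw [workload]
  split_ifs <;> linarith

theorem le_workload (j : Fin 3) (y : State) :
    23 / 2 * (y.1 0 : ℝ) + y.1 j - 3 / 2 ≤ workload j y := by
  rw [workload]
  split_ifs <;> linarith

theorem workload_eq_zero {j : Fin 3} {y : State} (h0 : y.1 0 = 0) (hj : y.1 j = 0) :
    workload j y = 0 := by
  simp [workload, h0, hj]

theorem queues_le_workload (j : Fin 3) (y : State) :
    (y.1 0 : ℝ) + y.1 j ≤ workload j y := by
  by_cases h : y.1 0 = 0
  · simp [workload, h]
  · have h1 : (1 : ℝ) ≤ y.1 0 := by exact_mod_cast Nat.one_le_iff_ne_zero.2 h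
    linarith [le_workload j y]

theorem abs_workload_sub_le (j : Fin 3) (y : State) (d b c : Fin 3 → Bool) :
    |workload j (priorityServed (transit y d b c)) - workload j y| ≤ 14 := by
  have h1 := workload_le j (priorityServed (transit y d b c))
  have h2 := le_workload j (priorityServed (transit y d b c))
  have h3 := workload_le j y
  have h4 := le_workload j y
  have k := transit_queue_bounds y d b c
  have k' := served_queue_bounds (priorityAction (transit y d b c)) (transit y d b c)
  rw [priorityServed] at h1 h2 ⊢
  rw [abs_le]
  constructor <;> linarith [k 0, k j, k' 0, k' j]

/-- After service under P0 no further service is possible. -/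
def IsServed (y : State) : Prop :=
  if y.1 0 = 0 then (y.2 1 = true → y.1 1 = 0) ∧ (y.2 2 = true → y.1 2 = 0)
  else ¬(y.2 0 = true ∧ y.2 1 = true ∧ y.2 2 = true)

theorem isServed_priorityServed (x : State) : IsServed (priorityServed x) := by
  obtain ⟨q, z⟩ := x
  obtain ⟨m, k, l, rfl⟩ := exists_eq_vec q
  obtain ⟨z0, z1, z2, rfl⟩ := exists_eq_vec z
  simp only [IsServed, priorityServed, served, used_zero, used_one, used_two, zero_mem_scheduled,
    one_mem_scheduled, two_mem_scheduled, priorityAction, Matrix.cons_val]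
  rcases m with _ | m
  · rcases k with _ | k <;> rcases l with _ | l <;> cases z1 <;> cases z2 <;> simp
  · cases z0 <;> cases z1 <;> cases z2 <;> simp

theorem workload_priorityServed {j : Fin 3} (hj : j = 1 ∨ j = 2) (x : State) :
    workload j (priorityServed x) =
      if x.1 0 = 0 then ((x.1 j - if x.2 j then 1 else 0 : ℕ) : ℝ)
      else if x.2 0 && x.2 1 && x.2 2 then 23 / 2 * (x.1 0 - 1) + x.1 j else workload j x := by
  obtain ⟨q, z⟩ := x
  obtain ⟨m, k, l, rfl⟩ := exists_eq_vec q
  obtain ⟨z0, z1, z2, rfl⟩ := exists_eq_vec z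
  rcases hj with rfl | rfl <;>
    simp only [workload, priorityServed, served, used_one, used_two, zero_mem_scheduled,
      one_mem_scheduled, two_mem_scheduled, priorityAction, Matrix.cons_val] <;>
    rcases m with _ | m
  · rcases k with _ | k <;> rcases l with _ | l <;> cases z1 <;> simp
  · cases z0 <;> cases z1 <;> cases z2 <;> simp
  · rcases k with _ | k <;> rcases l with _ | l <;> cases z2 <;> simp
  · cases z0 <;> cases z1 <;> cases z2 <;> simp

theorem workload_no_event {j : Fin 3} (hj : j = 1 ∨ j = 2) {y : State} (hy : IsServed y) :
    workload j (priorityServed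
      (transit y ![true, false, false] ![false, false, false] ![false, false, false])) =
    workload j y := by
  obtain ⟨q, z⟩ := y
  obtain ⟨m, k, l, rfl⟩ := exists_eq_vec q
  obtain ⟨z0, z1, z2, rfl⟩ := exists_eq_vec z
  simp only [IsServed, Matrix.cons_val] at hy
  rw [workload_priorityServed hj]
  rcases m with _ | m <;> rcases hj with rfl | rfl <;> cases z1 <;> cases z2 <;>
    simp at hy <;> simp [workload, transit, hy]

/-- While queue 0 is nonempty, the work decreases at rate 200 in every memory state: 400 · 1/2, 200
· 1 or 20 · 10. If queue 0 is empty, then queue j is nonempty with no server j stored, and each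
arriving server j removes a request. Arriving work amounts to at most 4 · 23/2 + 150 = 196. -/
theorem workload_events {j : Fin 3} (hj : j = 1 ∨ j = 2) {y : State} (hy : IsServed y)
    (hne : y.1 0 ≠ 0 ∨ y.1 j ≠ 0) {V : (Fin 3 → Bool) → (Fin 3 → Bool) → ℝ}
    (hV : ∀ b c, V b c = workload j y -
      workload j (priorityServed (transit y ![true, false, false] b c))) :
    4 ≤ 20 * V ![true, false, false] ![false, false, false] +
      200 * V ![false, true, false] ![false, false, false] +
      200 * V ![false, false, true] ![false, false, false] +
      4 * V ![false, false, false] ![true, false, false] +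
      150 * V ![false, false, false] ![false, true, false] +
      150 * V ![false, false, false] ![false, false, true] := by
  obtain ⟨q, z⟩ := y
  obtain ⟨m, k, l, rfl⟩ := exists_eq_vec q
  obtain ⟨z0, z1, z2, rfl⟩ := exists_eq_vec z
  simp only [IsServed, Matrix.cons_val] at hy
  simp only [hV, workload_priorityServed hj]
  rcases hj with rfl | rfl <;> simp only [workload, transit, Matrix.cons_val] at hne ⊢ <;>
    rcases m with _ | m
  · obtain ⟨n, rfl⟩ := Nat.exists_eq_succ_of_ne_zero (by simpa using hne : k ≠ 0)
    have hz : z1 = false := by simpa using hy.1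
    subst hz
    cases z2 <;> norm_num <;> linarith
  · cases z1 <;> cases z2 <;> norm_num <;> linarith
  · obtain ⟨n, rfl⟩ := Nat.exists_eq_succ_of_ne_zero (by simpa using hne : l ≠ 0)
    have hz : z2 = false := by simpa using hy.2
    subst hz
    cases z1 <;> norm_num <;> linarith
  · cases z1 <;> cases z2 <;> norm_num <;> linarith

/-- Expand the square: increments are at most 14 in size, whence 196 = 14². The drift 4h less the
error 3000000 · 14 h² is at least 3h. At workload zero the cross term vanishes, so no drift is
needed there. -/
theorem expect_sq_workload_le {h : ℝ} (h0 : 0 < h) (h1 : h ≤ 1 / 100000000) {j : Fin 3}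
    (hj : j = 1 ∨ j = 2) (x : State) :
    ((slotLaw h (priorityZero x)).expect fun w => workload j (priorityServed (slotNext x w)) ^ 2) ≤
      workload j (priorityServed x) ^ 2 - 6 * h * workload j (priorityServed x) + 196 := by
  rw [expect_slotLaw, priorityZero_eq, PMF.expect_pure]
  have hy := isServed_priorityServed x
  have hx : ∀ d b c, slotNext x (priorityAction x, d, b, c) = transit (priorityServed x) d b c :=
    fun _ _ _ => rfl
  simp only [hx]
  generalize priorityServed x = y at hy
  have hU : 0 ≤ workload j y := le_trans (by positivity) (queues_le_workload j y)
  have hb := abs_workload_sub_le j y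
  have hsq : ∀ d b c, workload j (priorityServed (transit y d b c)) ^ 2 ≤
      workload j y ^ 2 + 196 -
        2 * workload j y * (workload j y - workload j (priorityServed (transit y d b c))) := by
    intro d b c
    have := sq_le_sq' (abs_le.1 (hb d b c)).1 (abs_le.1 (hb d b c)).2
    linarith
  have e1 := (decoherenceLaw h).expect_mono fun d _ => (serverLaw h).expect_mono fun b _ =>
    (requestLaw h).expect_mono fun c _ => hsq d b c
  simp only [PMF.expect_sub, PMF.expect_add, PMF.expect_const_mul, PMF.expect_const] at e1
  refine e1.trans ?_
  suffices 2 * workload j y * (3 * h) ≤ 2 * workload j y * (workload j y -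
      (decoherenceLaw h).expect fun d => (serverLaw h).expect fun b =>
        (requestLaw h).expect fun c => workload j (priorityServed (transit y d b c))) by linarith
  by_cases hne : y.1 0 ≠ 0 ∨ y.1 j ≠ 0
  · refine mul_le_mul_of_nonneg_left ?_ (by positivity)
    have e2 := le_expect_events h0 (by linarith) (G := fun d b c =>
      workload j y - workload j (priorityServed (transit y d b c)))
      (fun d b c => by rw [abs_sub_comm]; exact hb d b c)
      (by rw [workload_no_event hj hy, sub_self])
    have e3 := workload_events hj hy hne (V := fun b c => workload j y -
      workload j (priorityServed (transit y ![true, false, false] b c))) fun _ _ => rfl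
    have e4 := mul_le_mul_of_nonneg_left e3 h0.le
    simp only [PMF.expect_sub, PMF.expect_const] at e2
    have e5 : 42000000 * h ^ 2 ≤ h := by nlinarith
    linarith
  · push Not at hne
    simp [workload_eq_zero hne.1 hne.2]

theorem meanHittingTime_priorityZero_lt_top {h : ℝ} (h0 : 0 < h) (h1 : h ≤ 1 / 100000000)
    (x y : State) : MarkovChain.meanHittingTime (netChain h priorityZero) x y < ∞ := by
  have hU : ∀ j x, 0 ≤ workload j (priorityServed x) := fun j x =>
    le_trans (by positivity) (queues_le_workload j (priorityServed x))
  refine (irreducible_priorityZero h0 (by linarith)).meanHittingTime_lt_top_of_expect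
    (netChain_eq h priorityZero)
    (V := fun x => workload 1 (priorityServed x) ^ 2 + workload 2 (priorityServed x) ^ 2)
    (fun x => by positivity)
    -- 393 = 2 · 196 + 1. Both workloads are needed for finiteness, since each ignores one of the
    -- queues 1 and 2.
    (S := {x | 6 * h * (workload 1 (priorityServed x) + workload 2 (priorityServed x)) ≤ 393})
    ?_ (b := 393) (by norm_num) (fun x => ?_) x y
  · obtain ⟨B, hB⟩ := exists_nat_ge (393 / (6 * h) + 1)
    refine ((Set.finite_Iic (fun _ : Fin 3 => B)).prod Set.finite_univ).subset fun x hx => ?_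
    refine ⟨fun r => ?_, Set.mem_univ _⟩
    have hx' : workload 1 (priorityServed x) + workload 2 (priorityServed x) ≤ 393 / (6 * h) := by
      rw [le_div_iff₀ (by positivity)]
      have : 6 * h * (workload 1 (priorityServed x) + workload 2 (priorityServed x)) ≤ 393 := hx
      linarith
    have k1 := queues_le_workload 1 (priorityServed x)
    have k2 := queues_le_workload 2 (priorityServed x)
    have p := fun i => ((priorityServed x).1 i).cast_nonneg (α := ℝ)
    have q := fun i => (served_queue_bounds (priorityAction x) x i).1
    rw [← priorityServed] at q
    have c0 : (x.1 0 : ℝ) ≤ B := by linarith [p 0, p 1, p 2, q 0]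
    have c1 : (x.1 1 : ℝ) ≤ B := by linarith [p 0, p 1, p 2, q 1]
    have c2 : (x.1 2 : ℝ) ≤ B := by linarith [p 0, p 1, p 2, q 2]
    fin_cases r
    · exact_mod_cast c0
    · exact_mod_cast c1
    · exact_mod_cast c2
  · rw [PMF.expect_add]
    have e1 := expect_sq_workload_le h0 h1 (Or.inl rfl) x
    have e2 := expect_sq_workload_le h0 h1 (Or.inr rfl) x
    have k1 := mul_nonneg h0.le (hU 1 x)
    have k2 := mul_nonneg h0.le (hU 2 x)
    by_cases hS : 6 * h * (workload 1 (priorityServed x) + workload 2 (priorityServed x)) ≤ 393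
    · rw [Set.indicator_of_mem (by exact hS)]
      linarith
    · rw [Set.indicator_of_notMem (by exact hS)]
      linarith

/-! ### The capacity region -/

/-- Use the action `a` with a small probability proportional to the slot length. -/
noncomputable def rarely (h : ℝ) (a : Action) : PMF Action :=
  -- As h → 0, the rate 14450 makes the service rates of `agnosticPolicy` about 4.2 for type 0 and
  -- 151.7 for types 1 and 2, above 4 and 150.
  (bernoulliVec fun _ : Fin 3 => toProb (14450 * h)).map fun b => if b 0 then a else .idle

theorem expect_rarely {h : ℝ} (h0 : 0 < h) (h1 : h ≤ 1 / 14450) (a : Action) (F : Action → ℝ) :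
    (rarely h a).expect F = (1 - 14450 * h) * F .idle + 14450 * h * F a := by
  rw [rarely, PMF.expect_map, expect_bernoulliVec, coe_toProb (by positivity) (by linarith)]
  simp
  ring

/-- A request-agnostic policy: a single stored server of type 1 or 2 is kept for a short random
time, and both together are kept until a server of type 0 arrives. -/
noncomputable def agnosticPolicy (h : ℝ) (z : Memory) : PMF Action :=
  if z 1 then
    if z 2 then PMF.pure (if z 0 then .serve0 else .idle) else rarely h .serve1
  else if z 2 then rarely h .serve2 else PMF.pure .idle

/-- A function of the memory, given by its values in the relevant states. -/
def memoryFunction (v₁ v₂ v₁₂ v₀₁₂ : ℝ) (z : Memory) : ℝ :=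
  if z 1 then if z 2 then if z 0 then v₀₁₂ else v₁₂ else v₁ else if z 2 then v₂ else 0

theorem abs_memoryFunction_le {v₁ v₂ v₁₂ v₀₁₂ : ℝ} (h₁ : |v₁| ≤ 10) (h₂ : |v₂| ≤ 10)
    (h₁₂ : |v₁₂| ≤ 10) (h₀₁₂ : |v₀₁₂| ≤ 10) (z : Memory) :
    |memoryFunction v₁ v₂ v₁₂ v₀₁₂ z| ≤ 10 := by
  rw [memoryFunction]
  split_ifs <;> first | assumption | norm_num

theorem expect_serverChain (h : ℝ) (π : Memory → PMF Action) (z : Memory) (f : Memory → ℝ) :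
    ((network ![20, 200, 200] h).serverChain π z).expect f = (π z).expect fun a =>
      (decoherenceLaw h).expect fun d => (serverLaw h).expect fun b =>
        f fun i => (z i && !used a z i && !d i) || b i := by
  simp only [MDPN.serverChain, network, decoherenceLaw, serverLaw, PMF.expect_bind, PMF.expect_map]

/-- Stationary service rates are bounded below by means of test functions. -/
theorem lt_stationary_rate {N : MDPN (Fin 3) Memory Action (Finset (Fin 3))}
    {π : Memory → PMF Action} {μ : PMF Memory} (hμ : μ.bind (N.serverChain π) = μ) {r : Fin 3}
    {l : ℝ} (f : Memory → ℝ)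
    (hf : ∀ z, l + f z ≤ (π z).expect (fun a => N.meanService a z r) +
      (N.serverChain π z).expect f) :
    l ≤ ∑ z, ∑ a, (μ z).toReal * (π z a).toReal * N.meanService a z r := by
  have h1 := μ.expect_mono fun z _ => hf z
  rw [PMF.expect_add, PMF.expect_add, PMF.expect_const, ← PMF.expect_bind, hμ] at h1
  have h2 : μ.expect (fun z => (π z).expect fun a => N.meanService a z r) =
      ∑ z, ∑ a, (μ z).toReal * (π z a).toReal * N.meanService a z r := by
    simp only [PMF.expect, Finset.mul_sum, mul_assoc]
  rw [← h2]
  linarith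

theorem le_expect_memoryFunction {h : ℝ} (h0 : 0 < h) (h1 : h ≤ 1 / 200) {v₁ v₂ v₁₂ v₀₁₂ : ℝ}
    (h₁ : |v₁| ≤ 10) (h₂ : |v₂| ≤ 10) (h₁₂ : |v₁₂| ≤ 10) (h₀₁₂ : |v₀₁₂| ≤ 10) (m : Memory) :
    (if m 1 then if m 2 then v₁₂ + 20 * h * (v₀₁₂ - v₁₂) else v₁ + 200 * h * (v₁₂ - v₁)
      else if m 2 then v₂ + 200 * h * (v₁₂ - v₂) else 200 * h * (v₁ + v₂)) - 60000000 * h ^ 2 ≤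
    (decoherenceLaw h).expect fun d => (serverLaw h).expect fun b =>
      memoryFunction v₁ v₂ v₁₂ v₀₁₂ fun i => (m i && !d i) || b i := by
  have hb := abs_memoryFunction_le h₁ h₂ h₁₂ h₀₁₂
  have e1 := le_expect_events h0 h1 (M := 20) (G := fun d b _ =>
    memoryFunction v₁ v₂ v₁₂ v₀₁₂ (fun i => (m i && !d i) || b i) -
      memoryFunction v₁ v₂ v₁₂ v₀₁₂ (fun i => (m i && !(![true, false, false] : Memory) i) ||
        (![false, false, false] : Memory) i))
    (fun d b _ => (abs_sub _ _).trans ((add_le_add (hb _) (hb _)).trans (by norm_num)))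
    (sub_self _)
  simp only [PMF.expect_sub, PMF.expect_const] at e1
  rw [le_sub_iff_add_le] at e1
  refine le_trans (le_of_eq ?_) e1
  obtain ⟨m0, m1, m2, rfl⟩ := exists_eq_vec m
  cases m1 <;> cases m2 <;> simp [memoryFunction] <;> ring

/-- The hypotheses `c₀` to `c₀₁₂` are the Poisson inequalities of the limiting memory process, state
by state, with value 0 at the memory states holding neither server 1 nor 2. Their slack 1/10 pays
for the O(h²) errors and leaves 1/100, which gives strict domination. -/
theorem le_agnostic_drift {h : ℝ} (h0 : 0 < h) (h1 : h ≤ 1 / 10000000000) {r : Fin 3}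
    {v₁ v₂ v₁₂ v₀₁₂ l : ℝ} (h₁ : |v₁| ≤ 10) (h₂ : |v₂| ≤ 10) (h₁₂ : |v₁₂| ≤ 10)
    (h₀₁₂ : |v₀₁₂| ≤ 10) (c₀ : l + 1 / 10 ≤ 200 * (v₁ + v₂))
    (c₁ : l + 1 / 10 ≤ 14450 * ((if r = 1 then 1 else 0) - v₁) + 200 * (v₁₂ - v₁))
    (c₂ : l + 1 / 10 ≤ 14450 * ((if r = 2 then 1 else 0) - v₂) + 200 * (v₁₂ - v₂))
    (c₁₂ : l + 1 / 10 ≤ 20 * (v₀₁₂ - v₁₂)) (c₀₁₂ : v₀₁₂ ≤ if r = 0 then 1 else 0) (z : Memory) :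
    (l + 1 / 100) * h + memoryFunction v₁ v₂ v₁₂ v₀₁₂ z ≤
      (agnosticPolicy h z).expect
        (fun a => (network ![20, 200, 200] h).meanService a z r) +
      ((network ![20, 200, 200] h).serverChain (agnosticPolicy h) z).expect
        (memoryFunction v₁ v₂ v₁₂ v₀₁₂) := by
  have hsq : 1000000000 * h ^ 2 ≤ 1 / 10 * h := by nlinarith
  have hE := fun a => le_expect_memoryFunction h0 (by linarith) h₁ h₂ h₁₂ h₀₁₂
    (fun i => z i && !used a z i)
  rw [expect_serverChain, ← PMF.expect_add]
  have hmono := (agnosticPolicy h z).expect_mono fun a _ =>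
    add_le_add (le_refl ((network ![20, 200, 200] h).meanService a z r)) (hE a)
  refine le_trans ?_ hmono
  clear hmono hE
  obtain ⟨z0, z1, z2, rfl⟩ := exists_eq_vec z
  have d₀ := mul_le_mul_of_nonneg_right c₀ h0.le
  have d₁ := mul_le_mul_of_nonneg_right c₁ h0.le
  have d₂ := mul_le_mul_of_nonneg_right c₂ h0.le
  have d₁₂ := mul_le_mul_of_nonneg_right c₁₂ h0.le
  rw [abs_le] at h₁ h₂ h₁₂ h₀₁₂
  have q : 0 ≤ h ^ 2 := by positivity
  have q₁ := mul_le_mul_of_nonneg_right h₁.1 q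
  have q₁' := mul_le_mul_of_nonneg_right h₁.2 q
  have q₂ := mul_le_mul_of_nonneg_right h₂.1 q
  have q₂' := mul_le_mul_of_nonneg_right h₂.2 q
  have q₁₂' := mul_le_mul_of_nonneg_right h₁₂.2 q
  simp only [meanService_eq, agnosticPolicy, memoryFunction, used_one, used_two,
    Matrix.cons_val]
  have hr : r = 0 ∨ r = 1 ∨ r = 2 := by fin_cases r <;> simp
  cases z1 <;> cases z2
  · simp only [Bool.false_eq_true, if_false, PMF.expect_pure]
    rcases hr with rfl | rfl | rfl <;>
      simp [zero_mem_scheduled, one_mem_scheduled, two_mem_scheduled] <;> linarith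
  · simp only [Bool.false_eq_true, if_false, if_true]
    rw [expect_rarely h0 (by linarith)]
    rcases hr with rfl | rfl | rfl <;>
      simp [zero_mem_scheduled, one_mem_scheduled, two_mem_scheduled] at d₂ ⊢ <;> linarith
  · simp only [Bool.false_eq_true, if_false, if_true]
    rw [expect_rarely h0 (by linarith)]
    rcases hr with rfl | rfl | rfl <;>
      simp [zero_mem_scheduled, one_mem_scheduled, two_mem_scheduled] at d₁ ⊢ <;> linarith
  · simp only [if_true, PMF.expect_pure]
    cases z0 <;> rcases hr with rfl | rfl | rfl <;>
      simp [zero_mem_scheduled, one_mem_scheduled, two_mem_scheduled] at c₀₁₂ ⊢ <;> linarith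

theorem mem_interiorCapacity {h : ℝ} (h0 : 0 < h) (h1 : h ≤ 1 / 10000000000) :
    (fun r => (arrivals ![4, 150, 150] h r : ℝ)) ∈
      (network ![20, 200, 200] h).interiorCapacity := by
  obtain ⟨μ, hμ⟩ :=
    PMF.exists_stationary ((network ![20, 200, 200] h).serverChain (agnosticPolicy h))
  refine ⟨fun r => (arrivals ![4, 150, 150] h r).2.1, agnosticPolicy h, μ, hμ, fun r => ?_⟩
  beta_reduce
  rw [coe_arrivals h0 (by linarith)]
  obtain rfl | rfl | rfl : r = 0 ∨ r = 1 ∨ r = 2 := by fin_cases r <;> simp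
  -- Relative values for gain 4.2: 4.2/400 = 0.0105 with one server stored, 1 - 4.2/20 = 0.79 with
  -- both.
  · refine lt_of_lt_of_le ?_ (lt_stationary_rate hμ (memoryFunction (105 / 10000) (105 / 10000)
      (79 / 100) 1) (le_agnostic_drift (l := 4) h0 h1 ?_ ?_ ?_ ?_ ?_ ?_ ?_ ?_ ?_))
    · simp
      linarith
    all_goals (try rw [if_neg (by decide)]) <;> norm_num [abs_le]
  -- Rounded relative values for a gain of about 151; a waiting pair has negative value, because it
  -- blocks memory for a mean time 1/20 without serving type 1.
  · refine lt_of_lt_of_le ?_ (lt_stationary_rate hμ (memoryFunction (873 / 1000) (-1135 / 10000)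
      (-755 / 100) 0) (le_agnostic_drift (l := 150) h0 h1 ?_ ?_ ?_ ?_ ?_ ?_ ?_ ?_ ?_))
    · simp
      linarith
    all_goals (try rw [if_neg (by decide)]) <;> norm_num [abs_le]
  · refine lt_of_lt_of_le ?_ (lt_stationary_rate hμ (memoryFunction (-1135 / 10000) (873 / 1000)
      (-755 / 100) 0) (le_agnostic_drift (l := 150) h0 h1 ?_ ?_ ?_ ?_ ?_ ?_ ?_ ?_ ?_))
    · simp
      linarith
    all_goals (try rw [if_neg (by decide)]) <;> norm_num [abs_le]

end ThreeQueue

theorem mainTheorem7 :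
    ∃ h₀ : ℝ, 0 < h₀ ∧ h₀ ≤ 1 / 200 ∧ ∀ h : ℝ, 0 < h → h < h₀ →
      -- the arrival rates can be strictly dominated by stationary service rates
      (fun r => (ThreeQueue.arrivals ![4, 150, 150] h r : ℝ)) ∈
          (ThreeQueue.network ![20, 200, 200] h).interiorCapacity ∧
      -- the network is stable under P0
      (MarkovChain.Irreducible ((ThreeQueue.network ![20, 200, 200] h).chain
            (ThreeQueue.arrivals ![4, 150, 150] h) ThreeQueue.priorityZero) ∧
        ∀ x, MarkovChain.PositiveRecurrentAt ((ThreeQueue.network ![20, 200, 200] h).chain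
            (ThreeQueue.arrivals ![4, 150, 150] h) ThreeQueue.priorityZero) x) ∧
      -- the network is unstable under MaxWeight, which is not throughput optimal
      ∀ π : MDPN.Policy (Fin 3) ThreeQueue.Memory ThreeQueue.Action,
        (ThreeQueue.network ![20, 200, 200] h).IsMaxWeight π →
          (∀ x, ¬ MarkovChain.PositiveRecurrentAt ((ThreeQueue.network ![20, 200, 200] h).chain
              (ThreeQueue.arrivals ![4, 150, 150] h) π) x) ∧
          ¬ (ThreeQueue.network ![20, 200, 200] h).ThroughputOptimal π := by
  refine ⟨1 / 10000000000, by norm_num, by norm_num, fun h h0 h1 => ?_⟩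
  have hcap := ThreeQueue.mem_interiorCapacity h0 h1.le
  refine ⟨hcap, ⟨ThreeQueue.irreducible_priorityZero h0 (by linarith), fun x =>
    ThreeQueue.meanHittingTime_priorityZero_lt_top h0 (by linarith) x x⟩, fun π hπ => ?_⟩
  have hnot := ThreeQueue.not_positiveRecurrentAt_of_isMaxWeight h0 (by linarith) hπ
  refine ⟨hnot, fun hopt => ?_⟩
  -- The mean hitting time of `y` from `y` itself is its mean return time.
  obtain ⟨y, hy⟩ := hopt _ hcap
  exact hnot y (hy y)
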